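/- Let $A,B\in\mathbb{Z}$, let $\ell\neq 2,3,5,7,13$ be a prime number with $\ell\nmid\Delta':=4A^3+27B^2$, and let $E/\mathbb{Q}$ be the elliptic curve $y^2=x^3+Ax+B$, assumed to be without complex multiplication (over $\overline{\mathbb{Q}}$). Let $L=\mathbb{Q}(E[\ell])$ be the field generated by the affine coordinates of the $\ell$-torsion points of $E(\overline{\mathbb{Q}})$, and assume that $\mathrm{Gal}(L/\mathbb{Q})\cong \mathrm{GL}_2(\mathbb{F}_\ell)$. For an $\mathbb{F}_\ell$-basis $(e_1,e_2)$ of $E[\ell]$ let $\widetilde\rho_\ell:\mathrm{Gal}(L/\mathbb{Q})\to \mathrm{GL}_2(\mathbb{F}_\ell)$ be the representation given by the Galois action on $E[\ell]$ (matrices acting on column vectors). Let $C>0$ be a real number and put $K_2=\mathbb{Q}(\mu_4)(\sqrt p : p\le C \text{ prime},\ p\ne \ell)$, $K_3=K_2(\sqrt \ell)$, and let $K'$ be the field obtained from $K_3$ by adjoining all the roots in $\overline{\mathbb{Q}}$ of the cubic equations $X^3+AX+B=u$, where $u$ runs over the rational numbers $a/b$ with $a,b\in\mathbb{Z}$, $1\le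 |a|,|b|\le C$. Then: a) $\mathbb{Q}(\mu_\ell)/\mathbb{Q}$ is the maximal abelian subextension of $L/\mathbb{Q}$, and, for every basis of $E[\ell]$, $\widetilde\rho_\ell$ maps $\mathrm{Gal}(L/\mathbb{Q}(\mu_\ell))$ onto $\mathrm{SL}_2(\mathbb{F}_\ell)$. b) $L\cap K_2=\mathbb{Q}$, and $[L\cap K_3:\mathbb{Q}]=2$. c) $L\cap K'\subseteq \mathbb{Q}(\mu_\ell)$. d) $L\cap K'=\mathbb{Q}(\mu_\ell)\cap K'$, and $[L\cap K':\mathbb{Q}]$ divides $12$. Moreover, for every basis $(e_1,e_2)$ of $E[\ell]$: e) For every prime divisor $d_0$ of $(\ell-1)/\gcd(\ell-1,12)$ there are an element $\sigma_0\in \mathrm{Gal}(L/(L\cap K'))$ of order $d_0$ and $\lambda_0\in\mathbb{F}_\ell^*$ of order $d_0$ with $\widetilde\rho_\ell(\sigma_0)=\begin{pmatrix}\lambda_0&0\\0&1\end{pmatrix}$; thus $\sigma_0$ acts on the line $\langle e_1\rangle$ as multiplication by $\lambda_0$ and on the line $\langle e_2\rangle$ trivially. f) There is exactly one $\tau\in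 \mathrm{Gal}(L/\mathbb{Q})$ with $\widetilde\rho_\ell(\tau)=\begin{pmatrix}1&0\\1&1\end{pmatrix}$; it belongs to $\mathrm{Gal}(L/(L\cap K'))$, and $\langle e_1\rangle$ is not stable under $\tau$. g) There is an element of order $(\ell-1)/\gcd(\ell-1,12)$ in $\mathbb{F}_\ell^*$, and for every such element $\lambda$ there is exactly one $\beta\in \mathrm{Gal}(L/\mathbb{Q})$ with $\widetilde\rho_\ell(\beta)=\begin{pmatrix}\lambda&0\\0&\lambda\end{pmatrix}$; it is non-trivial, it belongs to $\mathrm{Gal}(L/(L\cap K'))$ and lies in the center of that group, and $\beta-1$ is an automorphism of $E[\ell]$. -/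

import Mathlib

/-- The automorphism group `Gal(L/K)` of a subfield `L` of an extension `Ω` of `K`. -/
abbrev SubfieldGal {K Ω : Type} [Field K] [Field Ω] [Algebra K Ω] (L : IntermediateField K Ω) :
    Type := L ≃ₐ[K] L

/-- For subfields `L` and `M` of `Ω`: the subgroup `Gal(L/(L ∩ M))` of `Gal(L/K)`. -/
def galInter {K Ω : Type} [Field K] [Field Ω] [Algebra K Ω] (L M : IntermediateField K Ω) :
    Subgroup (SubfieldGal L) := (IntermediateField.comap L.val M).fixingSubgroup

/-- The subfield `M` is an abelian Galois extension of `K`. -/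
def IsAbelianSubext {K Ω : Type} [Field K] [Field Ω] [Algebra K Ω] (M : IntermediateField K Ω) :
    Prop := IsAbelianGalois K M

/-- A fixed algebraic closure of `ℚ`; all number fields below are subfields of it. -/
abbrev QBar : Type := AlgebraicClosure ℚ

noncomputable instance instDecidableEqQBar : DecidableEq QBar := Classical.decEq _

/-- Algebraicity for the `ℚ`-algebra structure that every field of characteristic zero carries. -/
instance instIsAlgebraicQBar : Algebra.IsAlgebraic ℚ QBar := by
  have h : @Algebra.IsAlgebraic ℚ QBar _ _ (AlgebraicClosure.instAlgebra ℚ) :=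
    AlgebraicClosure.isAlgebraic ℚ
  convert h
  exact Subsingleton.elim _ _

instance instIsAlgClosureQBar : IsAlgClosure ℚ QBar := ⟨inferInstance, inferInstance⟩

/-- The curve `y² = x³ + A x + B` over `ℚ`. -/
def shortCurve (A B : ℤ) : WeierstrassCurve ℚ := ⟨0, 0, 0, (A : ℚ), (B : ℚ)⟩

/-- The group `E(ℚ̄)`. -/
abbrev GeomPoint (W : WeierstrassCurve ℚ) : Type := (W.baseChange QBar).toAffine.Point

/-- A group endomorphism of `E(ℚ̄)` is algebraic if it is zero or if, at all but finitely many points,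
it is given by a pair of rational functions in the affine coordinates. On an elliptic curve these are
exactly the endomorphisms of `E` over `ℚ̄`: a rational map from a smooth curve extends to a morphism,
a non-zero endomorphism has finite kernel, and a homomorphism is determined by its values outside
a finite set. -/
def IsAlgebraicEndo (W : WeierstrassCurve ℚ) (φ : GeomPoint W →+ GeomPoint W) : Prop :=
  φ = 0 ∨ ∃ (f g h : MvPolynomial (Fin 2) QBar) (S : Set (GeomPoint W)), S.Finite ∧
    ∀ (x y : QBar) (hxy : (W.baseChange QBar).toAffine.Nonsingular x y),
      WeierstrassCurve.Affine.Point.some x y hxy ∉ S →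
        MvPolynomial.eval ![x, y] h ≠ 0 ∧
        ∃ hxy' : (W.baseChange QBar).toAffine.Nonsingular
            (MvPolynomial.eval ![x, y] f / MvPolynomial.eval ![x, y] h)
            (MvPolynomial.eval ![x, y] g / MvPolynomial.eval ![x, y] h),
          φ (WeierstrassCurve.Affine.Point.some x y hxy) =
            WeierstrassCurve.Affine.Point.some _ _ hxy'

/-- `E` has complex multiplication: over `ℚ̄` it has an endomorphism other than the
multiplications by integers. -/
def HasCM (W : WeierstrassCurve ℚ) : Prop :=
  ∃ φ : GeomPoint W →+ GeomPoint W, IsAlgebraicEndo W φ ∧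
    ∀ n : ℤ, φ ≠ n • AddMonoidHom.id (GeomPoint W)

/-- The group `E[ℓ]` of `ℓ`-torsion points over `ℚ̄`. -/
noncomputable abbrev ellTorsion (W : WeierstrassCurve ℚ) (l : ℕ) : AddSubgroup (GeomPoint W) :=
  AddSubgroup.torsionBy (GeomPoint W) (l : ℤ)

/-- `E[ℓ]` as a vector space over `𝔽_ℓ`. -/
noncomputable instance ellTorsionModule (W : WeierstrassCurve ℚ) (l : ℕ) :
    Module (ZMod l) (ellTorsion W l) := AddSubgroup.torsionBy.zmodModule

/-- The field `ℚ(E[ℓ])` generated by the affine coordinates of the `ℓ`-torsion points. -/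
noncomputable def divisionField (W : WeierstrassCurve ℚ) (l : ℕ) : IntermediateField ℚ QBar :=
  IntermediateField.adjoin ℚ {z | ∃ (x y : QBar)
    (h : (W.baseChange QBar).toAffine.Nonsingular x y),
      WeierstrassCurve.Affine.Point.some x y h ∈ ellTorsion W l ∧ (z = x ∨ z = y)}

/-- The group `Gal(ℚ(E[ℓ])/ℚ)`. -/
abbrev DivGal (W : WeierstrassCurve ℚ) (l : ℕ) : Type := SubfieldGal (divisionField W l)

/-- The action of an element of the absolute Galois group on `E[ℓ]`, coordinate by coordinate. -/
noncomputable def absGalAct (W : WeierstrassCurve ℚ) (l : ℕ) (s : QBar ≃ₐ[ℚ] QBar) :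
    ellTorsion W l →+ ellTorsion W l :=
  ((WeierstrassCurve.Affine.Point.map (W' := W) s.toAlgHom).comp
    (ellTorsion W l).subtype).codRestrict (ellTorsion W l) fun P => by
      rw [AddSubgroup.torsionBy.nsmul_iff, AddMonoidHom.comp_apply, ← map_nsmul]
      have h := AddSubgroup.torsionBy.nsmul_iff.mp P.2
      rw [AddSubgroup.coe_subtype, h, map_zero]

theorem absGalAct_congr (W : WeierstrassCurve ℚ) (l : ℕ) (s t : QBar ≃ₐ[ℚ] QBar)
    (h : ∀ z ∈ divisionField W l, s z = t z) : absGalAct W l s = absGalAct W l t := by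
  refine AddMonoidHom.ext ?_
  rintro ⟨P, hP⟩
  apply Subtype.ext
  change WeierstrassCurve.Affine.Point.map (W' := W) s.toAlgHom P =
    WeierstrassCurve.Affine.Point.map (W' := W) t.toAlgHom P
  rcases P with _ | ⟨x, y, hxy⟩
  · rfl
  · have hx := h x (IntermediateField.subset_adjoin _ _ ⟨x, y, hxy, hP, Or.inl rfl⟩)
    have hy := h y (IntermediateField.subset_adjoin _ _ ⟨x, y, hxy, hP, Or.inr rfl⟩)
    rw [WeierstrassCurve.Affine.Point.map_some, WeierstrassCurve.Affine.Point.map_some]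
    simp only [WeierstrassCurve.Affine.Point.some.injEq]
    exact ⟨hx, hy⟩

/-- The action of `Gal(ℚ(E[ℓ])/ℚ)` on `E[ℓ]`: an automorphism of `ℚ(E[ℓ])` is extended to `ℚ̄`
and applied to the coordinates (which lie in `ℚ(E[ℓ])`, so that the extension is immaterial). -/
noncomputable def galAct (W : WeierstrassCurve ℚ) (l : ℕ) :
    DivGal W l →* Module.End (ZMod l) (ellTorsion W l) where
  toFun s := (absGalAct W l (s.liftNormal QBar)).toZModLinearMap l
  map_one' := by
    have h : absGalAct W l ((1 : DivGal W l).liftNormal QBar) = absGalAct W l 1 :=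
      absGalAct_congr W l _ _ fun z hz =>
        AlgEquiv.liftNormal_commutes (1 : DivGal W l) QBar ⟨z, hz⟩
    rw [h]
    apply LinearMap.ext
    rintro ⟨P, hP⟩
    apply Subtype.ext
    rcases P with _ | ⟨x, y, hxy⟩ <;> rfl
  map_mul' s t := by
    have h : absGalAct W l ((s * t).liftNormal QBar) =
        absGalAct W l (s.liftNormal QBar * t.liftNormal QBar) :=
      absGalAct_congr W l _ _ fun z hz => by
        have h1 := AlgEquiv.liftNormal_commutes (s * t) QBar ⟨z, hz⟩
        have h2 := AlgEquiv.liftNormal_commutes t QBar ⟨z, hz⟩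
        have h3 := AlgEquiv.liftNormal_commutes s QBar (t ⟨z, hz⟩)
        change (s * t).liftNormal QBar z = _ at h1
        change t.liftNormal QBar z = _ at h2
        rw [AlgEquiv.mul_apply, h1, h2, h3, AlgEquiv.mul_apply]
    rw [h]
    apply LinearMap.ext
    rintro ⟨P, hP⟩
    apply Subtype.ext
    rcases P with _ | ⟨x, y, hxy⟩ <;> rfl

/-- The representation of `Gal(ℚ(E[ℓ])/ℚ)` in `GL₂(𝔽_ℓ)` given by the action on `E[ℓ]`, written in
a basis of `E[ℓ]` (matrices act on column vectors of coordinates). -/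
noncomputable def rhoTilde (W : WeierstrassCurve ℚ) (l : ℕ)
    (b : Module.Basis (Fin 2) (ZMod l) (ellTorsion W l)) :
    DivGal W l →* Matrix.GeneralLinearGroup (Fin 2) (ZMod l) :=
  MonoidHom.toHomUnits
    ((LinearMap.toMatrixAlgEquiv b : _ →* Matrix (Fin 2) (Fin 2) (ZMod l)).comp (galAct W l))

/-- For a subfield `M` of `ℚ̄` and `L = ℚ(E[ℓ])`: the subgroup `Gal(L/(L ∩ M))` of `Gal(L/ℚ)`. -/
noncomputable def galOver (W : WeierstrassCurve ℚ) (l : ℕ) (M : IntermediateField ℚ QBar) :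
    Subgroup (DivGal W l) := galInter (divisionField W l) M

/-- The cyclotomic field `ℚ(μ_n)`. -/
noncomputable def cycloField (n : ℕ) : IntermediateField ℚ QBar :=
  IntermediateField.adjoin ℚ {z | z ^ n = 1}

/-- `K₂ = ℚ(μ₄)(√p : p ≤ C prime, p ≠ ℓ)`. -/
noncomputable def fieldK2 (l : ℕ) (C : ℝ) : IntermediateField ℚ QBar :=
  cycloField 4 ⊔ IntermediateField.adjoin ℚ
    {z | ∃ p : ℕ, p.Prime ∧ p ≠ l ∧ (p : ℝ) ≤ C ∧ z ^ 2 = (p : QBar)}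

/-- `K₃ = K₂(√ℓ)`. -/
noncomputable def fieldK3 (l : ℕ) (C : ℝ) : IntermediateField ℚ QBar :=
  fieldK2 l C ⊔ IntermediateField.adjoin ℚ {z | z ^ 2 = (l : QBar)}

/-- The set of rationals `a / b` with integers `1 ≤ |a|, |b| ≤ C`. -/
def setU (C : ℝ) : Set ℚ :=
  {u | ∃ a b : ℤ, 1 ≤ |a| ∧ ((|a| : ℤ) : ℝ) ≤ C ∧ 1 ≤ |b| ∧ ((|b| : ℤ) : ℝ) ≤ C ∧
    u = (a : ℚ) / (b : ℚ)}

/-- `K₃` with the roots of `X³ + A X + B = u` adjoined. -/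
noncomputable def fieldK3y (A B : ℤ) (l : ℕ) (C : ℝ) (u : ℚ) : IntermediateField ℚ QBar :=
  fieldK3 l C ⊔ IntermediateField.adjoin ℚ
    {z | z ^ 3 + (A : QBar) * z + (B : QBar) = algebraMap ℚ QBar u}

/-- `K'`: the compositum, over `K₃`, of the fields `K₃^{(y)}` as `y²` runs over the set `setU C`. -/
noncomputable def fieldK' (A B : ℤ) (l : ℕ) (C : ℝ) : IntermediateField ℚ QBar :=
  fieldK3 l C ⊔ ⨆ u ∈ setU C, fieldK3y A B l C u

/-! Two facts carry the theorem: sixth powers of automorphisms act trivially on `K'`, and `L`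
contains `ℚ(μ_ℓ)`.

An automorphism `τ` of `ℚ̄` satisfies `τ² = 1` on square roots of rationals and `τ⁶ = 1` on roots of
rational cubics, so `Gal(L/(L ∩ K'))` contains every sixth power of `Gal(L/ℚ) ≅ GL₂(𝔽_ℓ)`.
Transvections generate `SL₂` and are sixth powers because `ℓ ∤ 6`; hence that group contains `SL₂`,
the commutator subgroup (`commutator_GL_two`, `commutator_le_of_pow_mem`). Its index divides 6
because `GL₂/SL₂` is cyclic (`index_dvd_of_pow_mem`). The elements asked for in e) and g) are sixth
powers of diagonal matrices, and the one in f) lies in `SL₂`. With squares in place of sixth powers,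
`L ∩ K₂` and `L ∩ K₃` have degree dividing 2.

Once a primitive `ℓ`-th root of unity lies in `L`, the group `Gal(L/ℚ(μ_ℓ))` contains the commutator
subgroup and has the same index `ℓ - 1`, so the two agree; this gives a) and c). The quadratic Gauss
sum is then a square root of `±ℓ` in `L ∩ K₃`, and a valuation argument at `ℓ` keeps it out of `K₂`
(`sqrt_notMem_adjoin`); this gives b).

The longest part shows `μ_ℓ ⊆ L` by building the Weil pairing as a commutator. For an `ℓ`-torsion
point `Q`, translation by `Q` followed by multiplication by a function with divisor `ℓ(-Q) - ℓ(∞)`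
acts on the finite-dimensional space of functions with a pole of order at most `ℓ` at infinity
(`exists_translation`). Such operators are unique up to scalars, so two of them commute up to a
scalar `ζ`, and `ζ^ℓ = 1`. If all of them commuted, a common eigenvector would have a zero at nearly
every translate of one of its zeros by the `ℓ²` torsion points, too many for its pole order
(`card_le_of_commute`). So some `ζ ≠ 1` occurs, and automorphisms fixing the torsion points fix it
(`exists_pow_eq_one_of_torsion`). -/

/-! ### Powers and commutators in `GL₂` over a field. -/

section GroupTheory

open Matrix Matrix.SpecialLinearGroup

theorem range_toGL_eq_ker_det {F : Type*} [Field F] :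
    (toGL : SpecialLinearGroup (Fin 2) F →* GL (Fin 2) F).range =
      (GeneralLinearGroup.det : GL (Fin 2) F →* Fˣ).ker := by
  ext g
  constructor
  · rintro ⟨s, rfl⟩
    exact Units.ext s.2
  · intro h
    exact ⟨⟨g.1, congrArg Units.val h⟩, Units.ext rfl⟩

/-- The determinant kills commutators, and conversely `SL₂` is perfect once the field has more than
three elements, which is what `a` witnesses. -/
theorem commutator_GL_two {F : Type*} [Field F] {a : F} (ha : a ≠ 0) (hasq : a ^ 2 ≠ 1) :
    commutator (GL (Fin 2) F) =
      (toGL : SpecialLinearGroup (Fin 2) F →* GL (Fin 2) F).range := by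
  apply le_antisymm
  · rw [range_toGL_eq_ker_det]
    exact Abelianization.commutator_subset_ker _
  · rw [MonoidHom.range_eq_map, ← SL2.commutator_eq_top ha hasq, commutator_def,
      Subgroup.map_commutator, commutator_def]
    exact Subgroup.commutator_mono le_top le_top

theorem transvection_pow {F : Type*} [Field F] {i j : Fin 2} (h : i ≠ j) (c : F) (n : ℕ) :
    SpecialLinearGroup.transvection h c ^ n = SpecialLinearGroup.transvection h (n * c) := by
  induction n with
  | zero => simp [transvection_coeff_zero]
  | succ n ih => rw [pow_succ, ih, ← transvection_add]; congr 1; push_cast; ring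

/-- A subgroup of `GL₂` that contains all `n`-th powers contains `SL₂`. -/
theorem range_toGL_le_of_pow_mem {F : Type*} [Field F] {n : ℕ} (hn : (n : F) ≠ 0)
    (H : Subgroup (GL (Fin 2) F)) (hH : ∀ g, g ^ n ∈ H) :
    (toGL : SpecialLinearGroup (Fin 2) F →* GL (Fin 2) F).range ≤ H := by
  rintro _ ⟨s, rfl⟩
  induction s using SL2.transvection_induction with
  | htransvec i j h c =>
    -- The transvection with entry `c` is the `n`-th power of the one with entry `c / n`.
    have := hH (toGL (SpecialLinearGroup.transvection h (c / n)))
    rwa [← map_pow, transvection_pow, mul_div_cancel₀ _ hn] at this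
  | hmul A B hA hB => rw [map_mul]; exact H.mul_mem hA hB

theorem index_range_toGL {F : Type*} [Field F] :
    (toGL : SpecialLinearGroup (Fin 2) F →* GL (Fin 2) F).range.index = Nat.card Fˣ := by
  rw [range_toGL_eq_ker_det, Subgroup.index_ker, MonoidHom.range_eq_top.mpr
    GeneralLinearGroup.det_surjective, Subgroup.card_top]

variable {G F : Type*} [Group G] [Field F]

theorem map_commutator_of_mulEquiv {H : Type*} [Group H] (e : G ≃* H) :
    (commutator G).map e.toMonoidHom = commutator H := by
  rw [commutator_def, Subgroup.map_commutator, commutator_def, ← MonoidHom.range_eq_map,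
    MonoidHom.range_eq_top.mpr e.surjective]

theorem commutator_le_of_pow_mem (e : G ≃* GL (Fin 2) F) {a : F} (ha : a ≠ 0)
    (hasq : a ^ 2 ≠ 1) {n : ℕ} (hn : (n : F) ≠ 0) (H : Subgroup G) (hH : ∀ g, g ^ n ∈ H) :
    commutator G ≤ H := by
  have h : (commutator G).map e.toMonoidHom ≤ H.map e.toMonoidHom := by
    rw [map_commutator_of_mulEquiv e, commutator_GL_two ha hasq]
    refine range_toGL_le_of_pow_mem hn _ fun g => ⟨e.symm g ^ n, hH _, ?_⟩
    simp
  exact (Subgroup.map_le_map_iff_of_injective e.injective).mp h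

theorem index_commutator (e : G ≃* GL (Fin 2) F) {a : F} (ha : a ≠ 0) (hasq : a ^ 2 ≠ 1) :
    (commutator G).index = Nat.card Fˣ := by
  rw [← index_range_toGL, ← commutator_GL_two ha hasq, ← map_commutator_of_mulEquiv e]
  exact (Subgroup.index_map_equiv _ e).symm

/-- Since `H` contains the kernel of the determinant, its index is that of its image in the cyclic
group `Fˣ`. The quotient is cyclic, so its order is its exponent, and `n` kills it. -/
theorem index_dvd_of_pow_mem [Finite F] (e : G ≃* GL (Fin 2) F) {a : F} (ha : a ≠ 0)
    (hasq : a ^ 2 ≠ 1) {n : ℕ} (H : Subgroup G) (hc : commutator G ≤ H)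
    (hH : ∀ g, g ^ n ∈ H) : H.index ∣ n := by
  let f : G →* Fˣ := GeneralLinearGroup.det.comp e.toMonoidHom
  have hf : Function.Surjective f := GeneralLinearGroup.det_surjective.comp e.surjective
  have hker : f.ker ≤ H := by
    refine le_trans (fun g hg => ?_) hc
    have h1 : e g ∈ (commutator G).map e.toMonoidHom := by
      rw [map_commutator_of_mulEquiv e, commutator_GL_two ha hasq, range_toGL_eq_ker_det]
      exact hg
    obtain ⟨g', hg', h⟩ := h1
    rwa [← e.injective h]
  rw [← Subgroup.comap_map_eq_self hker, Subgroup.index_comap_of_surjective _ hf,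
    Subgroup.index_eq_card, ← IsCyclic.exponent_eq_card]
  refine Monoid.exponent_dvd_of_forall_pow_eq_one fun x => ?_
  obtain ⟨y, rfl⟩ := QuotientGroup.mk_surjective x
  obtain ⟨g, rfl⟩ := hf y
  rw [← QuotientGroup.mk_pow, QuotientGroup.eq_one_iff, ← map_pow]
  exact Subgroup.mem_map_of_mem _ (hH g)

/-- Written as a power of a generator, `c` has exponent divisible by the gcd, and Bézout's identity
turns a gcd-th power into an `n`-th power. -/
theorem exists_pow_eq_of_pow_card_div_gcd_eq_one {C : Type*} [CommGroup C] [IsCyclic C] [Finite C]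
    {n : ℕ} {c : C} (hc : c ^ (Nat.card C / Nat.gcd (Nat.card C) n) = 1) : ∃ d : C, d ^ n = c := by
  obtain ⟨g, hg⟩ := IsCyclic.exists_generator (α := C)
  obtain ⟨k, rfl⟩ := mem_powers_iff_mem_zpowers.mpr (hg c)
  simp only at hc ⊢
  have hN : 0 < Nat.card C := Nat.card_pos
  rw [← pow_mul, ← orderOf_dvd_iff_pow_eq_one, orderOf_eq_card_of_forall_mem_zpowers hg] at hc
  have hd : Nat.gcd (Nat.card C) n ∣ k := by
    have h0 : 0 < Nat.card C / Nat.gcd (Nat.card C) n :=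
      Nat.div_pos (Nat.le_of_dvd hN (Nat.gcd_dvd_left _ _)) (Nat.gcd_pos_of_pos_left _ hN)
    refine Nat.dvd_of_mul_dvd_mul_right h0 ?_
    rwa [Nat.mul_div_cancel' (Nat.gcd_dvd_left _ _)]
  obtain ⟨m, rfl⟩ := hd
  refine ⟨g ^ (Nat.gcdB (Nat.card C) n * m), ?_⟩
  have h1 : g ^ (Nat.card C : ℤ) = 1 := by simp
  rw [← zpow_natCast, ← _root_.zpow_mul, ← zpow_natCast, Nat.cast_mul, Nat.gcd_eq_gcd_ab,
    show ((Nat.card C : ℤ) * Nat.gcdA (Nat.card C) n + n * Nat.gcdB (Nat.card C) n) * m =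
      Nat.card C * (Nat.gcdA (Nat.card C) n * m) + Nat.gcdB (Nat.card C) n * m * n by ring,
    _root_.zpow_add, _root_.zpow_mul g (Nat.card C : ℤ), h1, _root_.one_zpow, one_mul]

end GroupTheory

/-! ### Functions on the affine curve and their pole order at infinity. -/

section CoordinateRing

open Polynomial Module
open scoped Polynomial.Bivariate nonZeroDivisors

namespace WeierstrassCurve.Affine.CoordinateRing

variable {K : Type*} [Field K] {W : WeierstrassCurve.Affine K}

instance finite_coordinateRing : Module.Finite K[X] W.CoordinateRing :=
  .of_basis (CoordinateRing.basis W)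

/-- The functions on the affine curve with a pole of order at most `n` at infinity. -/
noncomputable def poleLE (W : WeierstrassCurve.Affine K) (n : ℕ) :
    Submodule K W.CoordinateRing where
  carrier := {u | (Algebra.norm K[X] u).degree ≤ n}
  zero_mem' := by
    change (Algebra.norm K[X] (0 : W.CoordinateRing)).degree ≤ n
    rw [Algebra.norm_zero, degree_zero]; exact bot_le
  add_mem' := by
    intro u v hu hv
    obtain ⟨p, q, rfl⟩ := exists_smul_basis_eq u
    obtain ⟨p', q', rfl⟩ := exists_smul_basis_eq v
    simp only [Set.mem_ofPred_eq] at hu hv ⊢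
    rw [show p • (1 : W.CoordinateRing) + q • mk W Y + (p' • 1 + q' • mk W Y) =
      (p + p') • 1 + (q + q') • mk W Y by rw [add_smul, add_smul]; abel]
    -- The norm of `p + q y` has degree `max (2 deg p) (2 deg q + 3)`, with no cancellation since
    -- the two numbers differ in parity. The bound is thus one on `p` and `q` separately and passes
    -- to sums.
    rw [degree_norm_smul_basis] at hu hv ⊢
    have h1 := degree_add_le p p'
    have h2 := degree_add_le q q'
    rcases le_total p.degree p'.degree with h | h <;> rcases le_total q.degree q'.degree with h' | h' <;>
    simp only [max_eq_left, max_eq_right, h, h'] at h1 h2 <;>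
    refine max_le (le_trans (nsmul_le_nsmul_right h1 2) ?_)
      (le_trans (add_le_add_left (nsmul_le_nsmul_right h2 2) 3) ?_) <;>
    first
    | exact (le_max_left _ _).trans hu
    | exact (le_max_left _ _).trans hv
    | exact (le_max_right _ _).trans hu
    | exact (le_max_right _ _).trans hv
  smul_mem' := by
    intro c u hu
    simp only [Set.mem_ofPred_eq] at hu ⊢
    rw [Algebra.smul_def, map_mul, IsScalarTower.algebraMap_apply K K[X] W.CoordinateRing,
      Algebra.norm_algebraMap, degree_mul, degree_pow, Polynomial.algebraMap_apply, Algebra.algebraMap_self,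
      RingHom.id_apply]
    refine (add_le_add (nsmul_le_nsmul_right degree_C_le _) hu).trans ?_
    simp

theorem mem_poleLE {n : ℕ} {u : W.CoordinateRing} :
    u ∈ poleLE W n ↔ (Algebra.norm K[X] u).degree ≤ n := Iff.rfl

theorem poleLE_mono {m n : ℕ} (h : m ≤ n) : poleLE W m ≤ poleLE W n := fun u hu => by
  rw [mem_poleLE] at *
  exact hu.trans (by exact_mod_cast h)

theorem mul_mem_poleLE {m n : ℕ} {u v : W.CoordinateRing} (hu : u ∈ poleLE W m)
    (hv : v ∈ poleLE W n) : u * v ∈ poleLE W (m + n) := by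
  rw [mem_poleLE] at *
  rw [map_mul, degree_mul]
  exact_mod_cast add_le_add hu hv

theorem algebraMap_mem_poleLE (c : K) (n : ℕ) : algebraMap K W.CoordinateRing c ∈ poleLE W n := by
  have h : (1 : W.CoordinateRing) ∈ poleLE W n := by
    rw [mem_poleLE, map_one, degree_one]; exact_mod_cast n.zero_le
  rw [Algebra.algebraMap_eq_smul_one]
  exact (poleLE W n).smul_mem c h

theorem one_mem_poleLE (n : ℕ) : (1 : W.CoordinateRing) ∈ poleLE W n := by
  simpa using algebraMap_mem_poleLE (W := W) 1 n

theorem pow_mem_poleLE {m : ℕ} {u : W.CoordinateRing} (hu : u ∈ poleLE W m) (k : ℕ) :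
    u ^ k ∈ poleLE W (k * m) := by
  induction k with
  | zero => simpa using one_mem_poleLE _
  | succ k ih => rw [pow_succ, add_mul, one_mul]; exact mul_mem_poleLE ih hu

/-- The coordinate function `x`. -/
noncomputable def xFun (W : WeierstrassCurve.Affine K) : W.CoordinateRing := mk W (C X)

/-- The coordinate function `y`. -/
noncomputable def yFun (W : WeierstrassCurve.Affine K) : W.CoordinateRing := mk W Y

theorem algebraMap_eq_mk (c : K) : algebraMap K W.CoordinateRing c = mk W (C (C c)) := rfl

theorem XClass_eq (x : K) : XClass W x = xFun W - algebraMap K _ x := by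
  rw [XClass, xFun, algebraMap_eq_mk, ← map_sub, ← C_sub]

theorem YClass_eq (y : K) : YClass W (C y) = yFun W - algebraMap K _ y := by
  rw [YClass, yFun, algebraMap_eq_mk, ← map_sub]

theorem yFun_sq : yFun W ^ 2 + algebraMap K _ W.a₁ * xFun W * yFun W +
    algebraMap K _ W.a₃ * yFun W = xFun W ^ 3 + algebraMap K _ W.a₂ * xFun W ^ 2 +
      algebraMap K _ W.a₄ * xFun W + algebraMap K _ W.a₆ := by
  simp only [xFun, yFun, algebraMap_eq_mk, ← map_pow, ← map_mul, ← map_add]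
  refine AdjoinRoot.mk_eq_mk.mpr ⟨1, ?_⟩
  rw [WeierstrassCurve.Affine.polynomial]
  simp only [C_add, C_mul, C_pow]
  ring

theorem smul_one_eq (p : K[X]) : p • (1 : W.CoordinateRing) = aeval (xFun W) p := by
  induction p using Polynomial.induction_on' with
  | add p q hp hq => rw [add_smul, hp, hq, map_add]
  | monomial n c =>
    rw [smul, mul_one, aeval_monomial, algebraMap_eq_mk, xFun, ← map_pow, ← map_mul, ← C_pow,
      ← C_mul, C_mul_X_pow_eq_monomial]

theorem exists_eq_aeval (u : W.CoordinateRing) : ∃ p q : K[X],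
    u = aeval (xFun W) p + aeval (xFun W) q * yFun W := by
  obtain ⟨p, q, rfl⟩ := exists_smul_basis_eq u
  refine ⟨p, q, ?_⟩
  rw [← smul_one_eq, ← smul_one_eq, smul_one_mul, yFun]

theorem degree_norm_aeval (p q : K[X]) :
    (Algebra.norm K[X] (aeval (xFun W) p + aeval (xFun W) q * yFun W)).degree =
      max (2 • p.degree) (2 • q.degree + 3) := by
  rw [← smul_one_eq, ← smul_one_eq, smul_one_mul, yFun, degree_norm_smul_basis]

theorem xFun_mem_poleLE : xFun W ∈ poleLE W 2 := by
  have h := degree_norm_aeval (W := W) X 0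
  simp only [aeval_X, map_zero, zero_mul, add_zero, degree_X, degree_zero] at h
  rw [mem_poleLE, h]
  simp

theorem yFun_mem_poleLE : yFun W ∈ poleLE W 3 := by
  have h := degree_norm_aeval (W := W) 0 1
  simp only [map_one, map_zero, one_mul, zero_add, degree_one, degree_zero] at h
  rw [mem_poleLE, h]
  simp

theorem XClass_mem_poleLE (x : K) : XClass W x ∈ poleLE W 2 := by
  rw [XClass_eq]
  exact sub_mem xFun_mem_poleLE (algebraMap_mem_poleLE _ _)

theorem YClass_mem_poleLE (y : K) : YClass W (C y) ∈ poleLE W 3 := by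
  rw [YClass_eq]
  exact sub_mem yFun_mem_poleLE (algebraMap_mem_poleLE _ _)

theorem natDegree_le_of_mem_poleLE {n : ℕ} {p q : K[X]}
    (h : aeval (xFun W) p + aeval (xFun W) q * yFun W ∈ poleLE W n) :
    2 * p.natDegree ≤ n ∧ (q ≠ 0 → 2 * q.natDegree + 3 ≤ n) := by
  rw [mem_poleLE, degree_norm_aeval, max_le_iff] at h
  constructor
  · by_cases hp : p = 0
    · simp [hp]
    · have := h.1
      rw [degree_eq_natDegree hp, nsmul_eq_mul] at this
      exact_mod_cast this
  · intro hq
    have := h.2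
    rw [degree_eq_natDegree hq, nsmul_eq_mul] at this
    exact_mod_cast this

theorem exists_algebraMap_eq_of_mem_poleLE_zero {u : W.CoordinateRing} (h : u ∈ poleLE W 0) :
    ∃ c : K, u = algebraMap K _ c := by
  obtain ⟨p, q, rfl⟩ := exists_eq_aeval u
  obtain ⟨h1, h2⟩ := natDegree_le_of_mem_poleLE h
  have hq : q = 0 := by by_contra hq; have := h2 hq; omega
  obtain ⟨c, hc⟩ := natDegree_eq_zero.mp (show p.natDegree = 0 by omega)
  exact ⟨c, by rw [hq, ← hc]; simp⟩

instance finiteDimensional_poleLE (n : ℕ) : FiniteDimensional K (poleLE W n) := by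
  let f : (degreeLT K (n + 1) × degreeLT K (n + 1)) →ₗ[K] W.CoordinateRing :=
    ((aeval (xFun W)).toLinearMap.comp (degreeLT K (n + 1)).subtype).coprod
      ((LinearMap.mulRight K (yFun W)).comp
        ((aeval (xFun W)).toLinearMap.comp (degreeLT K (n + 1)).subtype))
  refine Submodule.finiteDimensional_of_le (S₂ := LinearMap.range f) fun u hu => ?_
  obtain ⟨p, q, rfl⟩ := exists_eq_aeval u
  obtain ⟨h1, h2⟩ := natDegree_le_of_mem_poleLE hu
  have hp : p ∈ degreeLT K (n + 1) :=
    mem_degreeLT.mpr (degree_le_natDegree.trans_lt (by exact_mod_cast (by omega)))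
  have hq : q ∈ degreeLT K (n + 1) := by
    by_cases hq : q = 0
    · rw [hq]; exact Submodule.zero_mem _
    · have := h2 hq
      exact mem_degreeLT.mpr (degree_le_natDegree.trans_lt (by exact_mod_cast (by omega)))
  exact ⟨(⟨p, hp⟩, ⟨q, hq⟩), by simp [f]⟩

/-- The automorphism of the coordinate ring induced by the negation of the curve. -/
noncomputable def negHom (W : WeierstrassCurve.Affine K) :
    W.CoordinateRing →+* W.CoordinateRing :=
  AdjoinRoot.lift (AdjoinRoot.of _) (mk W W.negPolynomial) <| by
    have h : W.polynomial.eval₂ (AdjoinRoot.of W.polynomial) (mk W W.negPolynomial) =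
        mk W (W.polynomial.comp W.negPolynomial) := by
      rw [Polynomial.comp, Polynomial.hom_eval₂]; rfl
    rw [h]
    refine AdjoinRoot.mk_eq_zero.mpr ⟨1, ?_⟩
    rw [WeierstrassCurve.Affine.polynomial, WeierstrassCurve.Affine.negPolynomial]
    simp only [sub_comp, add_comp, mul_comp, pow_comp, X_comp, C_comp]
    ring

theorem negHom_mk_C (p : K[X]) : negHom W (mk W (C p)) = mk W (C p) :=
  AdjoinRoot.lift_of _

theorem negHom_yFun : negHom W (yFun W) = mk W W.negPolynomial :=
  AdjoinRoot.lift_root _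

/-- The coordinate ring is quadratic over `K[X]`, and negation on the curve is its conjugation. -/
theorem algebraMap_norm (u : W.CoordinateRing) :
    mk W (C (Algebra.norm K[X] u)) = u * negHom W u := by
  obtain ⟨p, q, rfl⟩ := exists_smul_basis_eq u
  refine (coe_norm_smul_basis p q).trans ?_
  have h := negHom_yFun (W := W)
  rw [yFun] at h
  simp only [smul, map_add, map_mul, negHom_mk_C, mul_one, h, WeierstrassCurve.Affine.negPolynomial,
    map_sub, map_neg]

theorem negHom_mem {x y : K} {u : W.CoordinateRing} (hu : u ∈ XYIdeal W x (C y)) :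
    negHom W u ∈ XYIdeal W x (C (W.negY x y)) := by
  suffices h : XYIdeal W x (C y) ≤ (XYIdeal W x (C (W.negY x y))).comap (negHom W) from h hu
  rw [XYIdeal, Ideal.span_le]
  have hX : XClass W x ∈ XYIdeal W x (C (W.negY x y)) := Ideal.subset_span (by simp)
  have hY : YClass W (C (W.negY x y)) ∈ XYIdeal W x (C (W.negY x y)) := Ideal.subset_span (by simp)
  rintro v (rfl | rfl)
  · change negHom W (XClass W x) ∈ XYIdeal W x (C (W.negY x y))
    rw [XClass, negHom_mk_C]
    exact hX
  · change negHom W (YClass W (C y)) ∈ XYIdeal W x (C (W.negY x y))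
    have : negHom W (YClass W (C y)) =
        -YClass W (C (W.negY x y)) - mk W (C (C W.a₁)) * XClass W x := by
      rw [YClass, map_sub, map_sub, negHom_mk_C]
      have h := negHom_yFun (W := W)
      rw [yFun] at h
      rw [h, YClass, XClass, ← map_neg, ← map_sub, ← map_mul, ← map_sub]
      congr 1
      rw [WeierstrassCurve.Affine.negPolynomial, WeierstrassCurve.Affine.negY]
      simp only [C_sub, C_mul, C_neg, C_add]
      ring
    rw [this]
    exact sub_mem (neg_mem hY) (Ideal.mul_mem_left _ _ hX)

theorem negHom_mem_pow {x y : K} {n : ℕ} {u : W.CoordinateRing} (hu : u ∈ XYIdeal W x (C y) ^ n) :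
    negHom W u ∈ XYIdeal W x (C (W.negY x y)) ^ n := by
  have h : XYIdeal W x (C y) ≤ (XYIdeal W x (C (W.negY x y))).comap (negHom W) :=
    fun u hu => negHom_mem hu
  exact Ideal.le_comap_pow _ n (Ideal.pow_right_mono h n hu)

theorem norm_ne_zero {u : W.CoordinateRing} (hu : u ≠ 0) : Algebra.norm K[X] u ≠ 0 :=
  Algebra.norm_ne_zero_iff.mpr hu

theorem natDegree_norm_mul {u v : W.CoordinateRing} (hu : u ≠ 0) (hv : v ≠ 0) :
    (Algebra.norm K[X] (u * v)).natDegree =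
      (Algebra.norm K[X] u).natDegree + (Algebra.norm K[X] v).natDegree := by
  rw [map_mul, natDegree_mul (norm_ne_zero hu) (norm_ne_zero hv)]

theorem natDegree_norm_XClass (x : K) : (Algebra.norm K[X] (XClass W x)).natDegree = 2 := by
  have h : XClass W x = aeval (xFun W) (X - C x) + aeval (xFun W) (0 : K[X]) * yFun W := by
    rw [XClass_eq]; simp
  apply natDegree_eq_of_degree_eq_some
  rw [h, degree_norm_aeval, degree_X_sub_C, degree_zero]
  rfl

theorem natDegree_norm_XClass_pow (x : K) (n : ℕ) :
    (Algebra.norm K[X] (XClass W x ^ n)).natDegree = 2 * n := by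
  rw [map_pow, natDegree_pow, natDegree_norm_XClass, mul_comm]

/-- A function that vanishes at `(x, y)` to order `n` has a norm of degree at least `n`. -/
theorem le_natDegree_norm {x y : K} (h : W.Nonsingular x y) {n : ℕ} {u : W.CoordinateRing}
    (hu : u ∈ XYIdeal W x (C y) ^ n) (h0 : u ≠ 0) : n ≤ (Algebra.norm K[X] u).natDegree := by
  -- The norm is `u` times its conjugate, which vanishes to order `n` at the negative point; the
  -- product of the two point ideals is generated by `X - x`. Taking norms once more doubles both
  -- degrees, giving the bound.
  have h1 : mk W (C (Algebra.norm K[X] u)) ∈ XIdeal W x ^ n := by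
    rw [algebraMap_norm, ← XYIdeal_neg_mul h, mul_comm (XYIdeal W x (C (W.negY x y))), mul_pow]
    exact Ideal.mul_mem_mul hu (negHom_mem_pow hu)
  rw [XIdeal, Ideal.span_singleton_pow, Ideal.mem_span_singleton] at h1
  have h2 : mk W (C (Algebra.norm K[X] u)) ≠ 0 :=
    (map_ne_zero_iff (algebraMap K[X] W.CoordinateRing)
      (FaithfulSMul.algebraMap_injective K[X] W.CoordinateRing)).mpr (norm_ne_zero h0)
  obtain ⟨v, hv⟩ := h1
  have hv0 : v ≠ 0 := by rintro rfl; exact h2 (by rw [hv, mul_zero])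
  have h3 := natDegree_norm_mul (pow_ne_zero n (XClass_ne_zero (W' := W) x)) hv0
  rw [← hv, natDegree_norm_XClass_pow] at h3
  have h4 : Algebra.norm K[X] (mk W (C (Algebra.norm K[X] u))) = Algebra.norm K[X] u ^ 2 := by
    have := Algebra.norm_algebraMap_of_basis (CoordinateRing.basis W) (Algebra.norm K[X] u)
    simpa using this
  rw [h4, natDegree_pow] at h3
  omega

end WeierstrassCurve.Affine.CoordinateRing

end CoordinateRing

/-! ### Translation by a point, with denominators cleared. -/

section Translation

open Polynomial Module
open scoped Polynomial.Bivariate nonZeroDivisors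

namespace WeierstrassCurve.Affine.CoordinateRing

variable {K : Type*} [Field K] {W : WeierstrassCurve.Affine K}

/-- Evaluation of functions at an affine point. -/
noncomputable def evalAt {x y : K} (h : W.Equation x y) : W.CoordinateRing →+* K :=
  AdjoinRoot.lift (evalRingHom x) y (by rw [eval₂_evalRingHom]; exact h)

theorem evalAt_algebraMap {x y : K} (h : W.Equation x y) (c : K) :
    evalAt h (algebraMap K _ c) = c := by
  rw [algebraMap_eq_mk]
  exact (AdjoinRoot.lift_of _).trans (eval_C)

theorem evalAt_xFun {x y : K} (h : W.Equation x y) : evalAt h (xFun W) = x :=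
  (AdjoinRoot.lift_of _).trans eval_X

theorem evalAt_yFun {x y : K} (h : W.Equation x y) : evalAt h (yFun W) = y :=
  AdjoinRoot.lift_root _

theorem evalAt_smul {x y : K} (h : W.Equation x y) (c : K) (u : W.CoordinateRing) :
    evalAt h (c • u) = c * evalAt h u := by
  rw [Algebra.smul_def, map_mul, evalAt_algebraMap]

theorem evalAt_XClass {x y : K} (h : W.Equation x y) (c : K) : evalAt h (XClass W c) = x - c := by
  rw [XClass_eq, map_sub, evalAt_xFun, evalAt_algebraMap]

theorem evalAt_YClass {x y : K} (h : W.Equation x y) (c : K) :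
    evalAt h (YClass W (C c)) = y - c := by
  rw [YClass_eq, map_sub, evalAt_yFun, evalAt_algebraMap]

theorem evalAt_norm {x y : K} (h : W.Equation x y) (u : W.CoordinateRing) :
    (Algebra.norm K[X] u).eval x = evalAt h u * evalAt h (negHom W u) := by
  rw [← map_mul, ← algebraMap_norm]
  exact (AdjoinRoot.lift_of (f := W.polynomial) (i := evalRingHom x) _).symm

theorem XClass_mem_XYIdeal (x y : K) : XClass W x ∈ XYIdeal W x (C y) :=
  Ideal.subset_span (by simp)

theorem YClass_mem_XYIdeal (x y : K) : YClass W (C y) ∈ XYIdeal W x (C y) :=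
  Ideal.subset_span (by simp)

/-- These are the addition formulas multiplied by `(x - x₀)²` and `(x - x₀)³`. Besides the values,
both the vanishing order at `(x₀, y₀)` and the pole order at infinity must be tracked. -/
theorem exists_numerators [DecidableEq K] (x₀ y₀ : K) :
    ∃ N₁ N₂ : W.CoordinateRing, N₁ ∈ XYIdeal W x₀ (C y₀) ^ 2 ∧ N₁ ∈ poleLE W 4 ∧
      N₂ ∈ XYIdeal W x₀ (C y₀) ^ 3 ∧ N₂ ∈ poleLE W 6 ∧
      ∀ {x y : K} (h : W.Equation x y), x ≠ x₀ →
        evalAt h N₁ = (x - x₀) ^ 2 * W.addX x x₀ (W.slope x x₀ y y₀) ∧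
        evalAt h N₂ = (x - x₀) ^ 3 * W.addY x x₀ y (W.slope x x₀ y y₀) := by
  let c : K →+* W.CoordinateRing := algebraMap K W.CoordinateRing
  set a := XClass W x₀ with ha
  set b := YClass W (C y₀) with hb
  have hA : a ∈ XYIdeal W x₀ (C y₀) := XClass_mem_XYIdeal _ _
  have hB : b ∈ XYIdeal W x₀ (C y₀) := YClass_mem_XYIdeal _ _
  have ha' : a = xFun W - c x₀ := XClass_eq _
  have hb' : b = yFun W - c y₀ := YClass_eq _
  have haP : a ∈ poleLE W 2 := XClass_mem_poleLE _
  have hbP : b ∈ poleLE W 3 := YClass_mem_poleLE _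
  have hc (t : K) (n : ℕ) {m : ℕ} {u : W.CoordinateRing} (hu : u ∈ poleLE W m) (hmn : m ≤ n) :
      c t * u ∈ poleLE W n := by
    have := (poleLE W m).smul_mem t hu
    rw [Algebra.smul_def] at this
    exact poleLE_mono hmn this
  have hc1 (t : K) (n : ℕ) : c t ∈ poleLE W n := algebraMap_mem_poleLE _ _
  have hsq := yFun_sq (W := W)
  change yFun W ^ 2 + c W.a₁ * xFun W * yFun W + c W.a₃ * yFun W = xFun W ^ 3 +
    c W.a₂ * xFun W ^ 2 + c W.a₄ * xFun W + c W.a₆ at hsq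
  let N₁ := b ^ 2 + c W.a₁ * (b * a) - (c W.a₂ + xFun W + c x₀) * a ^ 2
  let M := N₁ - c x₀ * a ^ 2
  let N₂ := -(b * M + c y₀ * a ^ 3) - c W.a₁ * (N₁ * a) - c W.a₃ * a ^ 3
  have haa : a ^ 2 ∈ XYIdeal W x₀ (C y₀) ^ 2 := Ideal.pow_mem_pow hA 2
  have haaa : a ^ 3 ∈ XYIdeal W x₀ (C y₀) ^ 3 := Ideal.pow_mem_pow hA 3
  have hN1 : N₁ ∈ XYIdeal W x₀ (C y₀) ^ 2 := by
    refine sub_mem (add_mem (Ideal.pow_mem_pow hB 2) (Ideal.mul_mem_left _ _ ?_))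
      (Ideal.mul_mem_left _ _ haa)
    rw [pow_two]; exact Ideal.mul_mem_mul hB hA
  have hM : M ∈ XYIdeal W x₀ (C y₀) ^ 2 := sub_mem hN1 (Ideal.mul_mem_left _ _ haa)
  have hN2 : N₂ ∈ XYIdeal W x₀ (C y₀) ^ 3 := by
    refine sub_mem (sub_mem (neg_mem (add_mem ?_ (Ideal.mul_mem_left _ _ haaa)))
      (Ideal.mul_mem_left _ _ ?_)) (Ideal.mul_mem_left _ _ haaa)
    · rw [pow_succ, mul_comm b]; exact Ideal.mul_mem_mul hM hB
    · rw [pow_succ]; exact Ideal.mul_mem_mul hN1 hA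
  -- `M` represents `(x - x₀)²` times the difference between the translated abscissa and `x₀`. Its
  -- terms have poles of order up to 6, but the curve equation cancels them down to order 3; this
  -- keeps `N₂`, which contains `b * M`, at order 6.
  have hMP : M ∈ poleLE W 3 := by
    have : M = -(c (W.a₃ + 2 * y₀ + W.a₁ * x₀) * yFun W) +
        c (W.a₄ - W.a₁ * y₀ + 2 * W.a₂ * x₀ + 3 * x₀ ^ 2) * xFun W +
        c (W.a₆ + y₀ ^ 2 + W.a₁ * x₀ * y₀ - W.a₂ * x₀ ^ 2 - 2 * x₀ ^ 3) := by
      simp only [M, N₁, ha', hb', map_add, map_sub, map_mul, map_pow, map_ofNat]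
      linear_combination hsq
    rw [this]
    exact add_mem (add_mem (neg_mem (hc _ _ yFun_mem_poleLE le_rfl))
      (hc _ _ xFun_mem_poleLE (by norm_num))) (hc1 _ _)
  have haP2 : a ^ 2 ∈ poleLE W 4 := pow_mem_poleLE haP 2
  have haP3 : a ^ 3 ∈ poleLE W 6 := pow_mem_poleLE haP 3
  have hN1P : N₁ ∈ poleLE W 4 := by
    have : N₁ = M + c x₀ * a ^ 2 := by ring
    rw [this]
    exact add_mem (poleLE_mono (by norm_num) hMP) (hc _ _ haP2 le_rfl)
  have hN2P : N₂ ∈ poleLE W 6 :=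
    sub_mem (sub_mem (neg_mem (add_mem (mul_mem_poleLE hbP hMP) (hc _ _ haP3 le_rfl)))
      (hc _ _ (mul_mem_poleLE hN1P haP) le_rfl)) (hc _ _ haP3 le_rfl)
  refine ⟨N₁, N₂, hN1, hN1P, hN2, hN2P, fun {x y} h hx => ?_⟩
  have hx' : x - x₀ ≠ 0 := sub_ne_zero.mpr hx
  have ec (t : K) : evalAt h (c t) = t := evalAt_algebraMap h t
  have ea : evalAt h a = x - x₀ := evalAt_XClass h _
  have eb : evalAt h b = y - y₀ := evalAt_YClass h _
  have e1 : evalAt h N₁ = (x - x₀) ^ 2 * W.addX x x₀ (W.slope x x₀ y y₀) := by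
    rw [slope_of_X_ne hx, addX]
    simp only [N₁, map_add, map_sub, map_mul, map_pow, ec, ea, eb, evalAt_xFun]
    field_simp
    ring
  refine ⟨e1, ?_⟩
  have : evalAt h N₂ = -((y - y₀) * (evalAt h N₁ - x₀ * (x - x₀) ^ 2) + y₀ * (x - x₀) ^ 3) -
      W.a₁ * (evalAt h N₁ * (x - x₀)) - W.a₃ * (x - x₀) ^ 3 := by
    simp only [N₂, M, map_add, map_sub, map_mul, map_pow, map_neg, ec, ea, eb]
  rw [this, e1, addY, negAddY, negY]
  generalize W.addX x x₀ (W.slope x x₀ y y₀) = t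
  rw [slope_of_X_ne hx]
  field_simp
  ring

end WeierstrassCurve.Affine.CoordinateRing

namespace WeierstrassCurve.Affine.Point

open WeierstrassCurve.Affine.CoordinateRing

variable {K : Type*} [Field K] {W : WeierstrassCurve.Affine K}

/-- The value of a function at a point, with the junk value `0` at infinity. -/
noncomputable def val (u : W.CoordinateRing) : W.Point → K
  | zero => 0
  | some _ _ h => evalAt h.1 u

theorem val_some (u : W.CoordinateRing) {x y : K} (h : W.Nonsingular x y) :
    val u (some x y h) = evalAt h.1 u := rfl

variable [DecidableEq K]

/-- Points map homomorphically to ideal classes, so an `n`-torsion point has an ideal whose `n`-th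
power is principal. The generator has divisor `n(Q) - n(∞)`. -/
theorem exists_span_eq_XYIdeal_pow {x y : K} (h : W.Nonsingular x y) {n : ℕ}
    (hn : n • some x y h = 0) :
    ∃ f : W.CoordinateRing, f ≠ 0 ∧ XYIdeal W x (C y) ^ n = Ideal.span {f} := by
  have h1 := congrArg (toClass (W := W)) hn
  rw [map_nsmul, toClass_some, _root_.map_zero] at h1
  have h2 : ClassGroup.mk W.FunctionField (CoordinateRing.XYIdeal' (W := W) h ^ n) = 1 := by
    rw [map_pow]
    exact h1
  refine (ClassGroup.mk_eq_one_of_coe_ideal (I' := XYIdeal W x (C y) ^ n) ?_).mp h2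
  rw [Units.val_pow_eq_pow_val, XYIdeal'_eq, FractionalIdeal.coeIdeal_pow]

/-- The numerator of the translate of a function by a point `(x₀, y₀)`. -/
theorem exists_translate_numerator {x₀ y₀ : K} (h₀ : W.Nonsingular x₀ y₀) {n : ℕ}
    {u : W.CoordinateRing} (hu : u ∈ poleLE W n) :
    ∃ N : W.CoordinateRing, N ∈ XYIdeal W x₀ (C y₀) ^ n ∧ N ∈ poleLE W (2 * n) ∧
      ∀ {x y : K} (h : W.Nonsingular x y), x ≠ x₀ →
        evalAt h.1 N = (x - x₀) ^ n * val u (some x y h + some x₀ y₀ h₀) := by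
  obtain ⟨N₁, N₂, hN1, hN1P, hN2, hN2P, hN⟩ := exists_numerators (W := W) x₀ y₀
  let S : Submodule K W.CoordinateRing :=
    { carrier := {u | ∃ N : W.CoordinateRing, N ∈ XYIdeal W x₀ (C y₀) ^ n ∧ N ∈ poleLE W (2 * n) ∧
        ∀ {x y : K} (h : W.Nonsingular x y), x ≠ x₀ →
          evalAt h.1 N = (x - x₀) ^ n * val u (some x y h + some x₀ y₀ h₀)}
      zero_mem' := by
        refine ⟨0, zero_mem _, zero_mem _, fun {x y} h hx => ?_⟩
        rw [add_of_X_ne hx, val_some, _root_.map_zero, _root_.map_zero, mul_zero]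
      add_mem' := by
        rintro u v ⟨N, h1, h2, h3⟩ ⟨N', h1', h2', h3'⟩
        refine ⟨N + N', add_mem h1 h1', add_mem h2 h2', fun {x y} h hx => ?_⟩
        rw [map_add, h3 h hx, h3' h hx, add_of_X_ne hx, val_some, val_some, val_some, map_add,
          mul_add]
      smul_mem' := by
        rintro c u ⟨N, h1, h2, h3⟩
        refine ⟨c • N, ?_, Submodule.smul_mem _ c h2, fun {x y} h hx => ?_⟩
        · rw [Algebra.smul_def]; exact Ideal.mul_mem_left _ _ h1
        rw [evalAt_smul, h3 h hx, add_of_X_ne hx, val_some, val_some, evalAt_smul,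
          mul_left_comm] }
  -- The natural denominator of this translate is `(x - x₀) ^ (2i + 3j)`; padding by the missing
  -- power of `x - x₀` brings the vanishing order to `n` and the pole order to `2n`.
  have key (i j : ℕ) (hij : 2 * i + 3 * j ≤ n) : xFun W ^ i * yFun W ^ j ∈ S := by
    refine ⟨N₁ ^ i * N₂ ^ j * XClass W x₀ ^ (n - 2 * i - 3 * j), ?_, ?_, fun {x y} h hx => ?_⟩
    · have := Ideal.mul_mem_mul (Ideal.mul_mem_mul (Ideal.pow_mem_pow hN1 i)
        (Ideal.pow_mem_pow hN2 j))
        (Ideal.pow_mem_pow (XClass_mem_XYIdeal (W := W) x₀ y₀) (n - 2 * i - 3 * j))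
      rw [← pow_mul, ← pow_mul, ← pow_add, ← pow_add] at this
      rwa [show 2 * i + 3 * j + (n - 2 * i - 3 * j) = n by omega] at this
    · refine poleLE_mono ?_ (mul_mem_poleLE (mul_mem_poleLE (pow_mem_poleLE hN1P i)
        (pow_mem_poleLE hN2P j)) (pow_mem_poleLE (XClass_mem_poleLE x₀) (n - 2 * i - 3 * j)))
      omega
    · obtain ⟨e1, e2⟩ := hN h.1 hx
      rw [add_of_X_ne hx, val_some, map_mul, map_mul, map_pow, map_pow, map_pow, e1, e2,
        evalAt_XClass, map_mul, map_pow, map_pow, evalAt_xFun, evalAt_yFun]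
      have : (x - x₀) ^ n = (x - x₀) ^ (2 * i) * (x - x₀) ^ (3 * j) *
          (x - x₀) ^ (n - 2 * i - 3 * j) := by
        rw [← pow_add, ← pow_add]; congr 1; omega
      rw [this, pow_mul, pow_mul]
      simp only [mul_pow]
      ring
  have key' (p : K[X]) (j : ℕ) (hp : p ≠ 0 → 2 * p.natDegree + 3 * j ≤ n) :
      aeval (xFun W) p * yFun W ^ j ∈ S := by
    by_cases hp0 : p = 0
    · rw [hp0, _root_.map_zero, zero_mul]; exact zero_mem S
    rw [aeval_eq_sum_range, Finset.sum_mul]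
    refine sum_mem fun i hi => ?_
    rw [smul_mul_assoc]
    refine S.smul_mem _ (key i j ?_)
    have := hp hp0
    have := Finset.mem_range.mp hi
    omega
  obtain ⟨p, q, rfl⟩ := exists_eq_aeval u
  obtain ⟨h1, h2⟩ := natDegree_le_of_mem_poleLE hu
  have hS : aeval (xFun W) p * yFun W ^ 0 + aeval (xFun W) q * yFun W ^ 1 ∈ S :=
    add_mem (key' p 0 fun _ => by omega) (key' q 1 fun hq => by have := h2 hq; omega)
  rw [pow_zero, mul_one, pow_one] at hS
  exact hS

end WeierstrassCurve.Affine.Point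

end Translation

/-! ### Zeros of functions, and translation operators for torsion points. -/

section TranslationOperator

open Polynomial Module
open scoped Polynomial.Bivariate

namespace WeierstrassCurve.Affine.CoordinateRing

variable {K : Type*} [Field K] {W : WeierstrassCurve.Affine K}

theorem mem_poleLE_iff_natDegree {n : ℕ} {u : W.CoordinateRing} :
    u ∈ poleLE W n ↔ (Algebra.norm K[X] u).natDegree ≤ n := by
  rw [mem_poleLE, natDegree_le_iff_degree_le]

theorem evalAt_aeval {x y : K} (h : W.Equation x y) (p : K[X]) :
    evalAt h (aeval (xFun W) p) = p.eval x := by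
  rw [← smul_one_eq, smul, mul_one]
  exact AdjoinRoot.lift_of _

theorem evalAt_negHom {x y : K} (h : W.Equation x y) (h' : W.Equation x (W.negY x y))
    (u : W.CoordinateRing) : evalAt h (negHom W u) = evalAt h' u := by
  obtain ⟨p, q, rfl⟩ := exists_eq_aeval u
  have hn (r : K[X]) : negHom W (aeval (xFun W) r) = aeval (xFun W) r := by
    rw [← smul_one_eq, smul, mul_one, negHom_mk_C]
  have hy : evalAt h (mk W W.negPolynomial) = W.negY x y := by
    have : mk W W.negPolynomial =
        -yFun W - algebraMap K _ W.a₁ * xFun W - algebraMap K _ W.a₃ := by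
      rw [WeierstrassCurve.Affine.negPolynomial, yFun, xFun, algebraMap_eq_mk, algebraMap_eq_mk,
        ← map_neg, ← map_mul, ← map_sub, ← map_sub]
      congr 1
      simp only [C_add, C_mul]
      ring
    rw [this]
    simp only [map_sub, map_neg, map_mul, evalAt_algebraMap, evalAt_xFun, evalAt_yFun,
      WeierstrassCurve.Affine.negY]
  rw [map_add, map_add, map_mul, map_mul, map_add, map_mul, negHom_yFun, hn, hn, hy, evalAt_aeval,
    evalAt_aeval, evalAt_aeval, evalAt_aeval, evalAt_yFun]

/-- The action on functions of an endomorphism of the base field that fixes the coefficients. -/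
noncomputable def coeffHom (W : WeierstrassCurve.Affine K) (σ : K →+* K) (h : W.map σ = W) :
    W.CoordinateRing →+* W.CoordinateRing :=
  AdjoinRoot.lift ((AdjoinRoot.of _).comp (mapRingHom σ)) (AdjoinRoot.root W.polynomial) <| by
    have : W.polynomial.map (mapRingHom σ) = W.polynomial := by
      rw [← WeierstrassCurve.Affine.map_polynomial, h]
    rw [← eval₂_map, this, AdjoinRoot.eval₂_root]

variable {σ : K →+* K} (hσ : W.map σ = W)

theorem coeffHom_aeval (p : K[X]) :
    coeffHom W σ hσ (aeval (xFun W) p) = aeval (xFun W) (p.map σ) := by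
  rw [← smul_one_eq, smul, mul_one, ← smul_one_eq, smul, mul_one]
  exact AdjoinRoot.lift_of _

theorem coeffHom_yFun : coeffHom W σ hσ (yFun W) = yFun W :=
  AdjoinRoot.lift_root _

theorem coeffHom_algebraMap (c : K) :
    coeffHom W σ hσ (algebraMap K _ c) = algebraMap K _ (σ c) := by
  have := coeffHom_aeval hσ (C c)
  rwa [aeval_C, map_C, aeval_C] at this

theorem coeffHom_xFun : coeffHom W σ hσ (xFun W) = xFun W := by
  have := coeffHom_aeval hσ X
  rwa [aeval_X, map_X, aeval_X] at this

theorem natDegree_norm_coeffHom (u : W.CoordinateRing) :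
    (Algebra.norm K[X] (coeffHom W σ hσ u)).natDegree = (Algebra.norm K[X] u).natDegree := by
  obtain ⟨p, q, rfl⟩ := exists_eq_aeval u
  apply natDegree_eq_of_degree_eq
  rw [map_add, map_mul, coeffHom_aeval, coeffHom_aeval, coeffHom_yFun, degree_norm_aeval,
    degree_norm_aeval, degree_map, degree_map]

theorem evalAt_coeffHom {x y : K} (h : W.Equation x y) (h' : W.Equation (σ x) (σ y))
    (u : W.CoordinateRing) : evalAt h' (coeffHom W σ hσ u) = σ (evalAt h u) := by
  obtain ⟨p, q, rfl⟩ := exists_eq_aeval u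
  simp only [map_add, map_mul, coeffHom_aeval, coeffHom_yFun, evalAt_aeval, evalAt_yFun,
    eval_map_apply]

theorem coeffHom_mem_pow {x y : K} (hx : σ x = x) (hy : σ y = y) {n : ℕ} {u : W.CoordinateRing}
    (hu : u ∈ XYIdeal W x (C y) ^ n) : coeffHom W σ hσ u ∈ XYIdeal W x (C y) ^ n := by
  have h : XYIdeal W x (C y) ≤ (XYIdeal W x (C y)).comap (coeffHom W σ hσ) := by
    nth_rw 1 [XYIdeal]
    rw [Ideal.span_le]
    rintro v (rfl | rfl)
    · change coeffHom W σ hσ (XClass W x) ∈ XYIdeal W x (C y)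
      rw [XClass_eq, map_sub, coeffHom_xFun, coeffHom_algebraMap, hx, ← XClass_eq]
      exact XClass_mem_XYIdeal _ _
    · change coeffHom W σ hσ (YClass W (C y)) ∈ XYIdeal W x (C y)
      rw [YClass_eq, map_sub, coeffHom_yFun, coeffHom_algebraMap, hy, ← YClass_eq]
      exact YClass_mem_XYIdeal _ _
  exact Ideal.le_comap_pow _ n (Ideal.pow_right_mono h n hu)

end WeierstrassCurve.Affine.CoordinateRing

namespace WeierstrassCurve.Affine.Point

open WeierstrassCurve.Affine.CoordinateRing

variable {K : Type*} [Field K] {W : WeierstrassCurve.Affine K}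

theorem val_mul (u v : W.CoordinateRing) (X : W.Point) : val (u * v) X = val u X * val v X := by
  rcases X with _ | ⟨x, y, h⟩
  · exact (mul_zero _).symm
  · exact map_mul _ _ _

theorem val_add (u v : W.CoordinateRing) (X : W.Point) : val (u + v) X = val u X + val v X := by
  rcases X with _ | ⟨x, y, h⟩
  · exact (add_zero _).symm
  · exact map_add _ _ _

theorem val_sub (u v : W.CoordinateRing) (X : W.Point) : val (u - v) X = val u X - val v X := by
  rcases X with _ | ⟨x, y, h⟩
  · exact (sub_zero _).symm
  · exact map_sub _ _ _

theorem val_smul (c : K) (u : W.CoordinateRing) (X : W.Point) : val (c • u) X = c * val u X := by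
  rcases X with _ | ⟨x, y, h⟩
  · exact (mul_zero _).symm
  · exact evalAt_smul _ _ _

theorem val_one {X : W.Point} (hX : X ≠ 0) : val (1 : W.CoordinateRing) X = 1 := by
  rcases X with _ | ⟨x, y, h⟩
  · exact absurd rfl hX
  · exact map_one _

/-- The abscissa of a point, with the junk value `0` at infinity. -/
noncomputable def abscissa (X : W.Point) : K := val (xFun W) X

theorem abscissa_some {x y : K} (h : W.Nonsingular x y) : abscissa (some x y h) = x :=
  evalAt_xFun _

theorem abscissa_eq_iff {P Q : W.Point} (hP : P ≠ 0) (hQ : Q ≠ 0) :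
    abscissa P = abscissa Q ↔ P = Q ∨ P = -Q := by
  rcases P with _ | ⟨x, y, h⟩
  · exact absurd rfl hP
  rcases Q with _ | ⟨x', y', h'⟩
  · exact absurd rfl hQ
  rw [abscissa_some, abscissa_some]
  exact X_eq_iff

/-- Abscissas of zeros are roots of the norm, and at most two points share an abscissa. The factor 2
is crude but harmless. -/
theorem card_zeros_le {u : W.CoordinateRing} (hu : u ≠ 0) (T : Finset W.Point)
    (hT : ∀ X ∈ T, X ≠ 0 ∧ val u X = 0) : T.card ≤ 2 * (Algebra.norm K[X] u).natDegree := by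
  classical
  have h1 : T.card ≤ 2 * (T.image abscissa).card := by
    refine Finset.card_le_mul_card_image T 2 fun a ha => ?_
    obtain ⟨X, hX, rfl⟩ := Finset.mem_image.mp ha
    refine (Finset.card_le_card (t := {X, -X}) fun P hP => ?_).trans Finset.card_le_two
    rw [Finset.mem_filter] at hP
    rw [Finset.mem_insert, Finset.mem_singleton]
    exact (abscissa_eq_iff (hT P hP.1).1 (hT X hX).1).mp hP.2
  refine h1.trans (Nat.mul_le_mul_left 2 ?_)
  have h2 : T.image abscissa ⊆ (Algebra.norm K[X] u).roots.toFinset := by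
    intro a ha
    obtain ⟨X, hX, rfl⟩ := Finset.mem_image.mp ha
    rw [Multiset.mem_toFinset, mem_roots (norm_ne_zero hu), IsRoot.def]
    obtain ⟨h0, hv⟩ := hT X hX
    rcases X with _ | ⟨x, y, h⟩
    · exact absurd rfl h0
    rw [abscissa_some, evalAt_norm h.1]
    rw [val_some] at hv
    rw [hv, zero_mul]
  exact (Finset.card_le_card h2).trans ((Multiset.toFinset_card_le _).trans (card_roots' _))

/-- The generator `f` and its analogue `g` at the negative point have norms of degree at least `n`,
while `f g` divides `(X - x)^n`, whose norm has degree `2n`. Both inequalities are therefore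
equalities. -/
theorem natDegree_norm_of_span_eq [DecidableEq K] {x y : K} (h : W.Nonsingular x y) {n : ℕ}
    (hn : n • some x y h = 0) {f : W.CoordinateRing}
    (hf : XYIdeal W x (C y) ^ n = Ideal.span {f}) (hf0 : f ≠ 0) :
    (Algebra.norm K[X] f).natDegree = n := by
  have hn' : n • some x (W.negY x y) ((nonsingular_neg x y).mpr h) = 0 := by
    rw [← neg_some h, smul_neg, hn, _root_.neg_zero]
  obtain ⟨g, hg0, hg⟩ := exists_span_eq_XYIdeal_pow _ hn'
  have h1 := le_natDegree_norm h (hf ▸ Ideal.mem_span_singleton_self f) hf0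
  have h2 := le_natDegree_norm ((nonsingular_neg x y).mpr h) (hg ▸ Ideal.mem_span_singleton_self g) hg0
  have h3 : XClass W x ^ n ∈ Ideal.span {f * g} := by
    rw [← Ideal.span_singleton_mul_span_singleton, ← hf, ← hg, ← mul_pow, mul_comm,
      XYIdeal_neg_mul h]
    exact Ideal.pow_mem_pow (Ideal.mem_span_singleton_self _) n
  obtain ⟨r, hr⟩ := Ideal.mem_span_singleton.mp h3
  have hr0 : r ≠ 0 := by
    rintro rfl
    exact pow_ne_zero n (XClass_ne_zero (W' := W) x) (by rw [hr, mul_zero])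
  have h4 := natDegree_norm_XClass_pow (W := W) x n
  rw [hr, natDegree_norm_mul (mul_ne_zero hf0 hg0) hr0, natDegree_norm_mul hf0 hg0] at h4
  omega

variable [IsAlgClosed K] [W.IsElliptic]

variable (W) in
theorem exists_abscissa_eq (x : K) : ∃ y, W.Nonsingular x y := by
  have hm : (W.polynomial.map (evalRingHom x)).natDegree = 2 := by
    rw [(WeierstrassCurve.Affine.monic_polynomial (W := W)).natDegree_map,
      WeierstrassCurve.Affine.natDegree_polynomial]
  obtain ⟨y, hy⟩ := IsAlgClosed.exists_root (W.polynomial.map (evalRingHom x)) (by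
    intro h
    have := natDegree_eq_of_degree_eq_some (n := 0) h
    omega)
  refine ⟨y, (W.equation_iff_nonsingular).mp ?_⟩
  rw [IsRoot.def, eval_map, eval₂_evalRingHom] at hy
  exact hy

instance infinite_point : Infinite W.Point := by
  choose f hf using exists_abscissa_eq W
  refine Infinite.of_injective (fun x => some x (f x) (hf x)) fun x x' h => ?_
  simpa only [abscissa_some] using congrArg abscissa h

theorem eq_zero_of_val_eq_zero {S : Set W.Point} (hS : S.Finite) {u : W.CoordinateRing}
    (hu : ∀ X ∉ S, val u X = 0) : u = 0 := by
  classical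
  by_contra h0
  have hinf : ((S ∪ {0})ᶜ : Set W.Point).Infinite := (hS.union (Set.finite_singleton _)).infinite_compl
  obtain ⟨T, hT, hc⟩ := hinf.exists_subset_card_eq (2 * (Algebra.norm K[X] u).natDegree + 1)
  have := card_zeros_le h0 T fun X hX => by
    have h1 := hT hX
    simp only [Set.mem_compl_iff, Set.mem_union, Set.mem_singleton_iff, not_or] at h1
    exact ⟨h1.2, hu X h1.1⟩
  omega

/-- A non-constant norm has a root; over that root `u` or its conjugate vanishes, so `u` vanishes at
a point or at its negative. -/
theorem exists_val_eq_zero {u : W.CoordinateRing} (hu : u ∉ poleLE W 0) :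
    ∃ X : W.Point, X ≠ 0 ∧ val u X = 0 := by
  obtain ⟨x, hx⟩ := IsAlgClosed.exists_root (Algebra.norm K[X] u) (by
    intro h
    exact hu (mem_poleLE.mpr h.le))
  obtain ⟨y, h⟩ := exists_abscissa_eq W x
  rw [IsRoot.def, evalAt_norm h.1, evalAt_negHom h.1 ((W.equation_neg ..).mpr h.1)] at hx
  rcases mul_eq_zero.mp hx with hx | hx
  · exact ⟨some _ _ h, some_ne_zero _, hx⟩
  · exact ⟨some _ _ ((nonsingular_neg ..).mpr h), some_ne_zero _, hx⟩

variable [DecidableEq K]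

/-- Translation by an `n`-torsion point `Q`, multiplied by a suitable function, acts on the space
of functions with a pole of order at most `n` at infinity. -/
theorem exists_translation {x₀ y₀ : K} (h₀ : W.Nonsingular x₀ y₀) {n : ℕ} (hn0 : 0 < n)
    (hn : n • some x₀ y₀ h₀ = 0) :
    ∃ (φ : W.Point → K) (U : Module.End K (poleLE W n)),
      (∀ X : W.Point, X ≠ 0 → X ≠ some x₀ y₀ h₀ → X ≠ -some x₀ y₀ h₀ → φ X ≠ 0 ∧
        ∀ u : poleLE W n, val (U u : W.CoordinateRing) X =
          φ X * val (u : W.CoordinateRing) (X + some x₀ y₀ h₀)) ∧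
      (∀ c : K, ∃ X : W.Point, X ≠ 0 ∧ X ≠ some x₀ y₀ h₀ ∧ X ≠ -some x₀ y₀ h₀ ∧ φ X ≠ c) ∧
      ∀ σ : K →+* K, W.map σ = W → σ x₀ = x₀ → σ y₀ = y₀ → ∃ c : K,
        ∀ {x y : K} (h : W.Nonsingular x y) (h' : W.Nonsingular (σ x) (σ y)), x ≠ x₀ →
          φ (some _ _ h') = c * σ (φ (some _ _ h)) := by
  set Q := some x₀ y₀ h₀ with hQ
  obtain ⟨f, hf0, hf⟩ := exists_span_eq_XYIdeal_pow h₀ hn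
  have hfd := natDegree_norm_of_span_eq h₀ hn hf hf0
  have hX : XClass W x₀ ^ n ∈ Ideal.span {f} :=
    hf ▸ Ideal.pow_mem_pow (XClass_mem_XYIdeal _ _) n
  obtain ⟨r, hr⟩ := Ideal.mem_span_singleton.mp hX
  have hfin : ({0, Q, -Q} : Set W.Point).Finite := Set.toFinite _
  have hne {x y : K} (h : W.Nonsingular x y) (hx : x ≠ x₀) : evalAt h.1 f ≠ 0 := by
    have := congrArg (evalAt h.1) hr
    rw [map_pow, evalAt_XClass, map_mul] at this
    exact left_ne_zero_of_mul (this ▸ pow_ne_zero n (sub_ne_zero.mpr hx))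
  have hxne {x y : K} (h : W.Nonsingular x y) (h1 : some x y h ≠ Q) (h2 : some x y h ≠ -Q) :
      x ≠ x₀ := fun hx => (X_eq_iff.mp hx).elim h1 h2
  -- The numerator lies in the ideal generated by `f`, and dividing by `f` lowers the pole order
  -- from `2n` to `n`.
  have hU (u : poleLE W n) : ∃ g : poleLE W n, ∀ {x y : K} (h : W.Nonsingular x y), x ≠ x₀ →
      evalAt h.1 f * evalAt h.1 (g : W.CoordinateRing) = (x - x₀) ^ n * val (u : W.CoordinateRing) (some x y h + Q) := by
    obtain ⟨N, hN, hNP, hNe⟩ := exists_translate_numerator h₀ u.2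
    rw [hf, Ideal.mem_span_singleton] at hN
    obtain ⟨g, rfl⟩ := hN
    refine ⟨⟨g, ?_⟩, fun {x y} h hx => by rw [← map_mul]; exact hNe h hx⟩
    by_cases hg0 : g = 0
    · rw [hg0]; exact zero_mem _
    rw [mem_poleLE_iff_natDegree, natDegree_norm_mul hf0 hg0] at hNP
    rw [mem_poleLE_iff_natDegree]
    omega
  choose U hU using hU
  -- As a function on the curve this has divisor `n(-Q) - n(∞)`.
  let φ : W.Point → K := fun X => val (XClass W x₀ ^ n) X / val f X
  have hUφ (X : W.Point) (h0 : X ≠ 0) (h1 : X ≠ Q) (h2 : X ≠ -Q) : φ X ≠ 0 ∧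
      ∀ u : poleLE W n, val (U u : W.CoordinateRing) X = φ X * val (u : W.CoordinateRing) (X + Q) := by
    rcases X with _ | ⟨x, y, h⟩
    · exact absurd rfl h0
    have hx := hxne h h1 h2
    simp only [φ, val_some, map_pow, evalAt_XClass]
    refine ⟨div_ne_zero (pow_ne_zero _ (sub_ne_zero.mpr hx)) (hne h hx), fun u => ?_⟩
    rw [div_mul_eq_mul_div, eq_div_iff (hne h hx), mul_comm]
    exact hU u h hx
  have hinj {u v : poleLE W n} (h : ∀ X : W.Point, X ≠ 0 → X ≠ Q → X ≠ -Q →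
      val (u : W.CoordinateRing) X = val (v : W.CoordinateRing) X) : u = v := by
    refine Subtype.ext (sub_eq_zero.mp (eq_zero_of_val_eq_zero hfin fun X hX => ?_))
    simp only [Set.mem_insert_iff, Set.mem_singleton_iff, not_or] at hX
    rw [val_sub, h X hX.1 hX.2.1 hX.2.2, sub_self]
  refine ⟨φ, { toFun := U, map_add' := fun u v => ?_, map_smul' := fun c u => ?_ }, hUφ, ?_, ?_⟩
  · refine hinj fun X h0 h1 h2 => ?_
    rw [Submodule.coe_add, val_add, (hUφ X h0 h1 h2).2, (hUφ X h0 h1 h2).2, (hUφ X h0 h1 h2).2,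
      Submodule.coe_add, val_add, mul_add]
  · refine hinj fun X h0 h1 h2 => ?_
    rw [RingHom.id_apply, Submodule.coe_smul, val_smul, (hUφ X h0 h1 h2).2, (hUφ X h0 h1 h2).2,
      Submodule.coe_smul, val_smul, mul_left_comm]
  · intro c
    by_contra! hc
    -- A constant multiplier would equate `(x - x₀)^n`, of pole order `2n`, with a multiple of `f`,
    -- of pole order `n`.
    have h1 : XClass W x₀ ^ n - c • f = 0 := by
      refine eq_zero_of_val_eq_zero hfin fun X hX => ?_
      simp only [Set.mem_insert_iff, Set.mem_singleton_iff, not_or] at hX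
      obtain ⟨h0, h1, h2⟩ := hX
      have := hc X h0 h1 h2
      rcases X with _ | ⟨x, y, h⟩
      · exact absurd rfl h0
      simp only [φ, val_some] at this
      rw [div_eq_iff (hne h (hxne h h1 h2))] at this
      rw [val_sub, val_smul, val_some, val_some, this, sub_self]
    rw [sub_eq_zero] at h1
    have h2 : XClass W x₀ ^ n ∈ poleLE W n := by
      rw [h1]
      exact Submodule.smul_mem _ c (mem_poleLE_iff_natDegree.mpr hfd.le)
    rw [mem_poleLE_iff_natDegree, natDegree_norm_XClass_pow] at h2
    omega
  · intro σ hσ hx₀ hy₀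
    -- As `σ` fixes `Q`, the conjugate of `f` is a multiple of `f` with the same degree, hence a
    -- constant multiple; this constant is `c`.
    have h1 := coeffHom_mem_pow hσ hx₀ hy₀ (hf ▸ Ideal.mem_span_singleton_self f)
    rw [hf, Ideal.mem_span_singleton] at h1
    obtain ⟨g, hg⟩ := h1
    have hd := natDegree_norm_coeffHom hσ f
    have hs0 : coeffHom W σ hσ f ≠ 0 := by
      intro h
      rw [h, hfd, Algebra.norm_zero, natDegree_zero] at hd
      omega
    have hg0 : g ≠ 0 := by rintro rfl; exact hs0 (by rw [hg, mul_zero])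
    rw [hg, natDegree_norm_mul hf0 hg0] at hd
    obtain ⟨c, rfl⟩ := exists_algebraMap_eq_of_mem_poleLE_zero
      (mem_poleLE_iff_natDegree.mpr (show (Algebra.norm K[X] g).natDegree ≤ 0 by omega))
    have hc0 : c ≠ 0 := by rintro rfl; exact hg0 (_root_.map_zero _)
    refine ⟨c, fun {x y} h h' hx => ?_⟩
    have h2 := evalAt_coeffHom hσ h.1 h'.1 f
    rw [hg, map_mul, evalAt_algebraMap] at h2
    simp only [φ, val_some, map_div₀, map_pow, evalAt_XClass, map_sub, hx₀, ← h2]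
    have h3 : evalAt h'.1 f ≠ 0 := hne h' (fun h => hx (σ.injective (h.trans hx₀.symm)))
    field_simp

end WeierstrassCurve.Affine.Point

end TranslationOperator

/-! ### The Heisenberg group of translation operators and the Weil pairing. -/

section HeisenbergGroup

open Polynomial Module

theorem exists_common_eigenvector {K V ι : Type*} [Field K] [IsAlgClosed K] [AddCommGroup V]
    [Module K V] [FiniteDimensional K V] [Nontrivial V] (U : ι → Module.End K V)
    (hU : ∀ i j, Commute (U i) (U j)) (s : Finset ι) :
    ∃ (c : ι → K) (v : V), v ≠ 0 ∧ ∀ i ∈ s, U i v = c i • v := by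
  classical
  induction s using Finset.induction_on with
  | empty =>
    obtain ⟨v, hv⟩ := exists_ne (0 : V)
    exact ⟨fun _ => 0, v, hv, by simp⟩
  | insert j s hj ih =>
    obtain ⟨c, v, hv, hvs⟩ := ih
    let E : Submodule K V := ⨅ i ∈ s, End.eigenspace (U i) (c i)
    have hE {w : V} : w ∈ E ↔ ∀ i ∈ s, U i w = c i • w := by
      simp [E, Submodule.mem_iInf]
    have hmap : ∀ w ∈ E, U j w ∈ E := fun w hw => hE.mpr fun i hi => by
      rw [← Module.End.mul_apply, (hU i j).eq, Module.End.mul_apply, hE.mp hw i hi, map_smul]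
    have : Nontrivial E := ⟨⟨⟨v, hE.mpr hvs⟩, 0, fun h => hv (congrArg Subtype.val h)⟩⟩
    obtain ⟨μ, hμ⟩ := End.exists_eigenvalue ((U j).restrict hmap)
    obtain ⟨w, hw, hw0⟩ := hμ.exists_hasEigenvector
    refine ⟨Function.update c j μ, w, fun h => hw0 (Subtype.ext h), fun i hi => ?_⟩
    rcases Finset.mem_insert.mp hi with rfl | hi
    · rw [Function.update_self]
      exact congrArg Subtype.val (End.mem_eigenspace_iff.mp hw)
    · rw [Function.update_of_ne (ne_of_mem_of_not_mem hi hj)]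
      exact hE.mp w.2 i hi

namespace WeierstrassCurve.Affine.Point

open WeierstrassCurve.Affine.CoordinateRing

variable {K : Type*} [Field K] [DecidableEq K] {W : WeierstrassCurve.Affine K}

/-- Outside `G`, the operator `U` is translation by `P` followed by multiplication by `φ`. -/
def IsTranslation (G : AddSubgroup W.Point) {n : ℕ} (P : W.Point) (φ : W.Point → K)
    (U : Module.End K (poleLE W n)) : Prop :=
  ∀ Z ∉ G, φ Z ≠ 0 ∧ ∀ u : poleLE W n, val (U u : W.CoordinateRing) Z =
    φ Z * val (u : W.CoordinateRing) (Z + P)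

variable {G : AddSubgroup W.Point} {n : ℕ} {P Q : W.Point} {φ ψ : W.Point → K}
  {U V : Module.End K (poleLE W n)}

theorem IsTranslation.one : IsTranslation G (n := n) 0 1 1 := fun Z _ =>
  ⟨one_ne_zero, fun u => by simp⟩

theorem IsTranslation.mul (hU : IsTranslation G P φ U) (hV : IsTranslation G Q ψ V) (hP : P ∈ G) :
    IsTranslation G (P + Q) (fun Z => φ Z * ψ (Z + P)) (U * V) := fun Z hZ => by
  have hZ' : Z + P ∉ G := fun h => hZ (by simpa using G.sub_mem h hP)
  refine ⟨mul_ne_zero (hU Z hZ).1 (hV _ hZ').1, fun u => ?_⟩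
  rw [Module.End.mul_apply, (hU Z hZ).2, (hV _ hZ').2, mul_assoc, add_assoc]

theorem IsTranslation.pow (hU : IsTranslation G P φ U) (hP : P ∈ G) (k : ℕ) :
    ∃ ψ, IsTranslation G (k • P) ψ (U ^ k) := by
  induction k with
  | zero => exact ⟨1, by simpa using IsTranslation.one⟩
  | succ k ih =>
    obtain ⟨ψ, hψ⟩ := ih
    exact ⟨_, by rw [succ_nsmul, pow_succ]; exact hψ.mul hU (G.nsmul_mem hP k)⟩

variable [IsAlgClosed K] [W.IsElliptic]

/-- The identity operator serves for `P = 0`. The exceptional set is only `{0, P, -P}`, not all of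
`G`, since the zero count in `card_le_of_commute` may have to evaluate at points of `G`. -/
theorem exists_isTranslation (hn0 : 0 < n) (hG : ∀ P ∈ G, n • P = 0) (hP : P ∈ G) :
    ∃ (φ : W.Point → K) (U : Module.End K (poleLE W n)),
      (∀ Z : W.Point, Z ≠ 0 → Z ≠ P → Z ≠ -P → φ Z ≠ 0 ∧ ∀ u : poleLE W n,
        val (U u : W.CoordinateRing) Z = φ Z * val (u : W.CoordinateRing) (Z + P)) ∧
      (P ≠ 0 → ∀ c : K, ∃ Z : W.Point, Z ≠ 0 ∧ Z ≠ P ∧ Z ≠ -P ∧ φ Z ≠ c) ∧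
      ∀ (σ : K →+* K) (s : W.Point →+ W.Point), W.map σ = W →
        (∀ x y h, ∃ h', s (some x y h) = some (σ x) (σ y) h') → s P = P →
          ∃ c : K, ∀ Z ∉ G, φ (s Z) = c * σ (φ Z) := by
  rcases P with _ | ⟨x₀, y₀, h₀⟩
  · refine ⟨1, 1, fun Z _ _ _ => ⟨one_ne_zero, fun u => ?_⟩, fun h => absurd rfl h,
      fun σ s _ _ _ => ⟨1, fun Z _ => by simp⟩⟩
    rw [← zero_def, add_zero, Module.End.one_apply, Pi.one_apply, one_mul]
  · obtain ⟨φ, U, h1, h2, h3⟩ := exists_translation h₀ hn0 (hG _ hP)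
    refine ⟨φ, U, h1, fun _ => h2, fun σ s hσ hs hsP => ?_⟩
    obtain ⟨h₀', e⟩ := hs x₀ y₀ h₀
    rw [hsP, some.injEq] at e
    obtain ⟨c, hc⟩ := h3 σ hσ e.1.symm e.2.symm
    refine ⟨c, fun Z hZ => ?_⟩
    rcases Z with _ | ⟨x, y, h⟩
    · exact absurd G.zero_mem hZ
    obtain ⟨h', e'⟩ := hs x y h
    rw [e']
    refine hc h h' fun hx => hZ ?_
    rcases X_eq_iff.mp hx with hx | hx
    · exact hx ▸ hP
    · exact hx ▸ G.neg_mem hP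

variable [Finite G]

theorem eq_of_val_eq {u v : poleLE W n} (h : ∀ Z ∉ G,
    val (u : W.CoordinateRing) Z = val (v : W.CoordinateRing) Z) : u = v := by
  refine Subtype.ext (sub_eq_zero.mp (eq_zero_of_val_eq_zero (S := (G : Set W.Point))
    (Set.toFinite _) fun Z hZ => ?_))
  rw [val_sub, h Z hZ, sub_self]

theorem IsTranslation.injective (hU : IsTranslation G P φ U) (hP : P ∈ G) :
    Function.Injective U := by
  rw [injective_iff_map_eq_zero]
  intro u hu
  refine eq_of_val_eq (G := G) fun Z hZ => ?_
  have hZ' : Z - P ∉ G := fun h => hZ (by simpa using G.add_mem h hP)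
  have h := (hU _ hZ').2 u
  rw [hu, sub_add_cancel] at h
  have h0 : val ((0 : poleLE W n) : W.CoordinateRing) (Z - P) = 0 := by
    rw [← zero_smul K (0 : poleLE W n), Submodule.coe_smul, val_smul, zero_mul]
  have h0' : val ((0 : poleLE W n) : W.CoordinateRing) Z = 0 := by
    rw [← zero_smul K (0 : poleLE W n), Submodule.coe_smul, val_smul, zero_mul]
  rw [h0] at h
  rw [h0', (mul_eq_zero.mp h.symm).resolve_left (hU _ hZ').1]

instance nontrivial_poleLE : Nontrivial (poleLE W n) :=
  ⟨⟨⟨1, one_mem_poleLE n⟩, 0, fun h => one_ne_zero (congrArg Subtype.val h)⟩⟩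

/-- Off `G` the operator is multiplication by `φ`, so an eigenvector `v` with eigenvalue `c` gives
`(U u - c u) v = 0`, and the coordinate ring is a domain. -/
theorem IsTranslation.exists_eq_smul_one (hU : IsTranslation G 0 φ U) :
    ∃ c : K, U = c • (1 : Module.End K (poleLE W n)) := by
  obtain ⟨c, hc⟩ := End.exists_eigenvalue U
  obtain ⟨v, hv, hv0⟩ := hc.exists_hasEigenvector
  have hv' := End.mem_eigenspace_iff.mp hv
  refine ⟨c, LinearMap.ext fun u => ?_⟩
  have h : ((U u : W.CoordinateRing) - c • (u : W.CoordinateRing)) * (v : W.CoordinateRing) = 0 := by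
    refine eq_zero_of_val_eq_zero (S := (G : Set W.Point)) (Set.toFinite _) fun Z hZ => ?_
    have h1 := (hU Z hZ).2 u
    have h2 := (hU Z hZ).2 v
    rw [hv', Submodule.coe_smul, val_smul] at h2
    rw [add_zero] at h1 h2
    rw [val_mul, val_sub, val_smul, h1]
    linear_combination (-val (u : W.CoordinateRing) Z) * h2
  have h0 : (v : W.CoordinateRing) ≠ 0 := fun h => hv0 (Subtype.ext h)
  exact Subtype.ext (sub_eq_zero.mp ((mul_eq_zero.mp h).resolve_right h0))

/-- `V U⁻¹` lifts the trivial translation, hence is a scalar. -/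
theorem IsTranslation.exists_eq_smul (hU : IsTranslation G P φ U) (hV : IsTranslation G P ψ V)
    (hP : P ∈ G) : ∃ c : K, V = c • U := by
  let e := LinearEquiv.ofInjectiveEndo U (hU.injective hP)
  have he (u) : U (e.symm u) = u := e.apply_symm_apply u
  have he' (u) : e.symm (U u) = u := e.symm_apply_apply u
  have h1 : IsTranslation G (-P) (fun Z => (φ (Z - P))⁻¹) e.symm.toLinearMap := fun Z hZ => by
    have hZ' : Z - P ∉ G := fun h => hZ (by simpa using G.add_mem h hP)
    refine ⟨inv_ne_zero (hU _ hZ').1, fun u => ?_⟩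
    have h := (hU _ hZ').2 (e.symm u)
    rw [he, sub_add_cancel] at h
    rw [← sub_eq_add_neg, h, inv_mul_cancel_left₀ (hU _ hZ').1]
    rfl
  have h2 := hV.mul h1 hP
  rw [add_neg_cancel] at h2
  obtain ⟨c, hc⟩ := h2.exists_eq_smul_one
  refine ⟨c, LinearMap.ext fun u => ?_⟩
  have := LinearMap.congr_fun hc (U u)
  simpa [he'] using this

/-- If the translations by the points of a finite group `G` of points of odd prime order `n` lift to
commuting operators, then `G` has at most `2 n + 2` elements. -/
theorem card_le_of_commute (hn : Odd n) (hG : ∀ P ∈ G, n • P = 0)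
    {φ : G → W.Point → K} {U : G → Module.End K (poleLE W n)}
    (hU : ∀ (R : G) (Z : W.Point), Z ≠ 0 → Z ≠ R → Z ≠ -R → φ R Z ≠ 0 ∧ ∀ u : poleLE W n,
      val (U R u : W.CoordinateRing) Z = φ R Z * val (u : W.CoordinateRing) (Z + R))
    (hφ : ∀ R : G, (R : W.Point) ≠ 0 → ∀ c : K, ∃ Z : W.Point, Z ≠ 0 ∧ Z ≠ R ∧ Z ≠ -R ∧ φ R Z ≠ c)
    (hc : ∀ R S, Commute (U R) (U S)) : Nat.card G ≤ 2 * n + 2 := by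
  classical
  have := Fintype.ofFinite G
  by_contra! hcard
  have hT (R : G) : IsTranslation G (R : W.Point) (φ R) (U R) := fun Z hZ =>
    hU R Z (fun h => hZ (h ▸ G.zero_mem)) (fun h => hZ (h ▸ R.2)) fun h => hZ (h ▸ G.neg_mem R.2)
  obtain ⟨c, u, hu0, hu⟩ := exists_common_eigenvector U hc Finset.univ
  have hu0' : (u : W.CoordinateRing) ≠ 0 := fun h => hu0 (Subtype.ext h)
  have hc0 (R : G) : c R ≠ 0 := fun h => hu0 <| (hT R).injective R.2 <| by
    rw [hu R (Finset.mem_univ _), h, zero_smul, LinearMap.map_zero]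
  have hval (R : G) (Z : W.Point) (h0 : Z ≠ 0) (h1 : Z ≠ R) (h2 : Z ≠ -R) :
      c R * val (u : W.CoordinateRing) Z = φ R Z * val (u : W.CoordinateRing) (Z + R) := by
    rw [← (hU R Z h0 h1 h2).2, hu R (Finset.mem_univ _), Submodule.coe_smul, val_smul]
  -- A constant eigenvector would make `φ R` constant for a non-zero `R`.
  have hconst : (u : W.CoordinateRing) ∉ poleLE W 0 := by
    intro h
    obtain ⟨a, ha⟩ := exists_algebraMap_eq_of_mem_poleLE_zero h
    have ha0 : a ≠ 0 := by rintro rfl; exact hu0' (by rw [ha, _root_.map_zero])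
    have : Nontrivial G := Finite.one_lt_card_iff_nontrivial.mp (by omega)
    obtain ⟨R, hR⟩ := exists_ne (0 : G)
    have hR' : (R : W.Point) ≠ 0 := fun h => hR (Subtype.ext h)
    obtain ⟨Z, h0, h1, h2, h3⟩ := hφ R hR' (c R)
    have hv {Z : W.Point} (hZ : Z ≠ 0) : val (u : W.CoordinateRing) Z = a := by
      rw [ha, Algebra.algebraMap_eq_smul_one, val_smul, val_one hZ, mul_one]
    have := hval R Z h0 h1 h2
    rw [hv h0, hv (fun h => h2 (eq_neg_of_add_eq_zero_left h))] at this
    exact h3 (mul_right_cancel₀ ha0 this).symm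
  obtain ⟨Z₀, hZ₀, hz⟩ := exists_val_eq_zero hconst
  -- For these `R` the point `Z₀ - R` is neither `0` nor `R`, so the eigenvector relation makes it a
  -- zero of `u`. Each condition excludes at most one `R`, the second because `n` is odd: this is
  -- the `+ 2` in the bound.
  let S : Finset G := Finset.univ.filter fun R => (R : W.Point) ≠ Z₀ ∧ (R : W.Point) + R ≠ Z₀
  have hS := card_zeros_le hu0' (S.image fun R : G => Z₀ - (R : W.Point)) fun Z hZ => by
    obtain ⟨R, hR, rfl⟩ := Finset.mem_image.mp hZ
    obtain ⟨-, hR1, hR2⟩ := Finset.mem_filter.mp hR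
    have h0 : Z₀ - R ≠ 0 := sub_ne_zero.mpr (Ne.symm hR1)
    refine ⟨h0, ?_⟩
    have := hval R (Z₀ - R) h0 (fun h => hR2 (sub_eq_iff_eq_add.mp h).symm)
      (fun h => hZ₀ (by simpa [sub_eq_add_neg] using h))
    rw [sub_add_cancel, hz, mul_zero] at this
    exact (mul_eq_zero.mp this).resolve_left (hc0 R)
  rw [Finset.card_image_of_injective _ fun R R' h => Subtype.ext (sub_right_injective h)] at hS
  have hdeg := mem_poleLE_iff_natDegree.mp u.2
  have h1 : (Finset.univ.filter fun R : G => (R : W.Point) = Z₀).card ≤ 1 :=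
    Finset.card_le_one.mpr fun R hR R' hR' => Subtype.ext
      ((Finset.mem_filter.mp hR).2.trans (Finset.mem_filter.mp hR').2.symm)
  have h2 : (Finset.univ.filter fun R : G => (R : W.Point) + R = Z₀).card ≤ 1 :=
    Finset.card_le_one.mpr fun R hR R' hR' => by
      have h := (Finset.mem_filter.mp hR).2.trans (Finset.mem_filter.mp hR').2.symm
      have h2 : (2 : ℕ) • ((R : W.Point) - R') = 0 := by
        rw [smul_sub, two_nsmul, two_nsmul, h, sub_self]
      have hn' : n • ((R : W.Point) - R') = 0 := hG _ (G.sub_mem R.2 R'.2)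
      obtain ⟨k, rfl⟩ := hn
      rw [add_smul, one_smul, mul_comm, mul_smul, h2, smul_zero, zero_add] at hn'
      exact Subtype.ext (sub_eq_zero.mp hn')
  have h3 : (Finset.univ : Finset G) ⊆ S ∪
      ((Finset.univ.filter fun R : G => (R : W.Point) = Z₀) ∪
        (Finset.univ.filter fun R : G => (R : W.Point) + R = Z₀)) := by
    intro R _
    simp only [S, Finset.mem_union, Finset.mem_filter, Finset.mem_univ, true_and]
    tauto
  have h4 := (Finset.card_le_card h3).trans ((Finset.card_union_le _ _).trans
    (Nat.add_le_add_left (Finset.card_union_le _ _) _))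
  rw [Finset.card_univ, ← Nat.card_eq_fintype_card] at h4
  omega

/-- The Weil pairing takes a non-trivial value on a sufficiently large group `G` of points of odd
order `n`, and its values are fixed by the automorphisms that fix `G`. -/
theorem exists_pow_eq_one_of_torsion (hn : Odd n) (hG : ∀ P ∈ G, n • P = 0)
    (hcard : 2 * n + 2 < Nat.card G) :
    ∃ ζ : K, ζ ≠ 1 ∧ ζ ^ n = 1 ∧ ∀ (σ : K →+* K) (s : W.Point →+ W.Point), W.map σ = W →
      (∀ x y h, ∃ h', s (some x y h) = some (σ x) (σ y) h') → (∀ P ∈ G, s P = P) → σ ζ = ζ := by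
  choose φ U hU hφ hσ using fun R : G => exists_isTranslation hn.pos hG R.2
  have hT (R : G) : IsTranslation G (R : W.Point) (φ R) (U R) := fun Z hZ =>
    hU R Z (fun h => hZ (h ▸ G.zero_mem)) (fun h => hZ (h ▸ R.2)) fun h => hZ (h ▸ G.neg_mem R.2)
  have hex : ∃ P Q : G, U P * U Q ≠ U Q * U P := by
    by_contra! h
    exact absurd (card_le_of_commute hn hG hU hφ h) (by omega)
  obtain ⟨P, Q, hPQ⟩ := hex
  have h1 := (hT P).mul (hT Q) P.2
  have h2 := (hT Q).mul (hT P) Q.2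
  rw [add_comm] at h2
  obtain ⟨ζ, hζ⟩ := h2.exists_eq_smul h1 (G.add_mem P.2 Q.2)
  refine ⟨ζ, ?_, ?_, ?_⟩
  · rintro rfl
    exact hPQ (by rw [hζ, one_smul])
  -- For `k = n` the operator `U P ^ n` lifts translation by `n P = 0`, so it is a non-zero scalar
  -- and `ζ ^ n = 1`.
  · have hk (k : ℕ) : U P ^ k * U Q = ζ ^ k • (U Q * U P ^ k) := by
      induction k with
      | zero => simp
      | succ k ih =>
        rw [pow_succ, mul_assoc, hζ, mul_smul_comm, ← mul_assoc, ih, smul_mul_assoc, smul_smul,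
          pow_succ' ζ, mul_assoc]
    obtain ⟨ψ, hψ⟩ := (hT P).pow P.2 n
    rw [hG _ P.2] at hψ
    obtain ⟨c, hc⟩ := hψ.exists_eq_smul_one
    have h3 := hk n
    rw [hc, smul_mul_assoc, one_mul, mul_smul_comm, mul_one, smul_smul] at h3
    obtain ⟨u, hu⟩ := exists_ne (0 : poleLE W n)
    have hQu : U Q u ≠ 0 := fun h => hu ((hT Q).injective Q.2 (by rw [h, LinearMap.map_zero]))
    have hPu : (U P ^ n) u ≠ 0 := fun h => hu (hψ.injective G.zero_mem (by rw [h, LinearMap.map_zero]))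
    have hc0 : c ≠ 0 := by
      rintro rfl
      exact hPu (by rw [hc, zero_smul, LinearMap.zero_apply])
    have h4 := LinearMap.congr_fun h3 u
    rw [LinearMap.smul_apply, LinearMap.smul_apply] at h4
    have h5 := smul_left_injective K hQu h4
    exact mul_right_cancel₀ hc0 (by rw [← h5, one_mul])
  · intro σ s hW hs hsG
    obtain ⟨Z, hZ⟩ := (Set.toFinite (G : Set W.Point)).exists_notMem
    have hs_mem {Z : W.Point} (hZ : Z ∉ G) : s Z ∉ G := by
      intro h
      have hinj : Function.Injective s := by
        rw [injective_iff_map_eq_zero]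
        rintro (_ | ⟨x, y, h⟩) hx
        · rfl
        · obtain ⟨h', e⟩ := hs x y h
          exact absurd (e ▸ hx) (some_ne_zero h')
      exact hZ (hinj (hsG _ h) ▸ h)
    -- The commutation relation applied to the constant function 1 expresses `ζ` through the
    -- multipliers alone.
    have key {Z : W.Point} (hZ : Z ∉ G) :
        φ P Z * φ Q (Z + P) = ζ * (φ Q Z * φ P (Z + Q)) := by
      let u : poleLE W n := ⟨1, one_mem_poleLE n⟩
      have hZ' : Z + (P + Q) ≠ 0 := fun h => hZ (by
        rw [eq_neg_of_add_eq_zero_left h]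
        exact G.neg_mem (G.add_mem P.2 Q.2))
      have e1 := (h1 Z hZ).2 u
      have e2 := (h2 Z hZ).2 u
      rw [val_one hZ', mul_one] at e1 e2
      rw [hζ, LinearMap.smul_apply, Submodule.coe_smul, val_smul, e2] at e1
      exact e1.symm
    -- The constants by which `σ` distorts the two multipliers occur on both sides of `key` at `s Z`
    -- and cancel.
    obtain ⟨c, hc⟩ := hσ P σ s hW hs (hsG _ P.2)
    obtain ⟨d, hd⟩ := hσ Q σ s hW hs (hsG _ Q.2)
    have hmem {Z R : W.Point} (hZ : Z ∉ G) (hR : R ∈ G) : Z + R ∉ G :=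
      fun h => hZ (by simpa using G.sub_mem h hR)
    have k1 := congrArg σ (key hZ)
    have k2 := key (hs_mem hZ)
    have eP : s Z + P = s (Z + P) := by rw [map_add, hsG _ P.2]
    have eQ : s Z + Q = s (Z + Q) := by rw [map_add, hsG _ Q.2]
    rw [eP, eQ, hc _ hZ, hd _ hZ, hd _ (hmem hZ P.2), hc _ (hmem hZ Q.2)] at k2
    rw [map_mul, map_mul, map_mul] at k1
    have hc0 : c ≠ 0 := fun h => (hT P _ (hs_mem hZ)).1 (by rw [hc _ hZ, h, zero_mul])
    have hd0 : d ≠ 0 := fun h => (hT Q _ (hs_mem hZ)).1 (by rw [hd _ hZ, h, zero_mul])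
    have hne : c * d * (σ (φ Q Z) * σ (φ P (Z + Q))) ≠ 0 :=
      mul_ne_zero (mul_ne_zero hc0 hd0) (mul_ne_zero
        ((map_ne_zero σ).mpr (hT Q _ hZ).1) ((map_ne_zero σ).mpr (hT P _ (hmem hZ Q.2)).1))
    refine mul_right_cancel₀ hne ?_
    linear_combination (-c * d) * k1 + k2

end WeierstrassCurve.Affine.Point

end HeisenbergGroup

/-! ### Galois groups over intersections of fields. -/

section GaloisTheory

variable {K Ω : Type} [Field K] [Field Ω] [Algebra K Ω]

theorem mem_galInter {L M : IntermediateField K Ω} {σ : SubfieldGal L} :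
    σ ∈ galInter L M ↔ ∀ x : L, (x : Ω) ∈ M → σ x = x :=
  ⟨fun h x hx => h ⟨x, hx⟩, fun h x => h x.1 x.2⟩

theorem inf_le_of_galInter_le {L M₁ M₂ : IntermediateField K Ω} [IsGalois K L]
    (h : galInter L M₁ ≤ galInter L M₂) : L ⊓ M₂ ≤ M₁ := by
  rintro x ⟨hL, hM⟩
  have h1 : (⟨x, hL⟩ : L) ∈ IntermediateField.fixedField (galInter L M₁) :=
    IntermediateField.mem_fixedField_iff _ _ |>.mpr fun σ hσ => mem_galInter.mp (h hσ) _ hM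
  rw [galInter, InfiniteGalois.fixedField_fixingSubgroup] at h1
  exact h1

theorem finrank_inf_eq_index_galInter (L M : IntermediateField K Ω) [IsGalois K L] :
    Module.finrank K ↥(L ⊓ M) = (galInter L M).index := by
  rw [galInter, ← IntermediateField.finrank_eq_fixingSubgroup_index]
  have h : (IntermediateField.comap L.val M).map L.val = L ⊓ M := by
    ext x
    constructor
    · rintro ⟨y, hy, rfl⟩
      exact ⟨y.2, hy⟩
    · rintro ⟨hL, hM⟩
      exact ⟨⟨x, hL⟩, hM, rfl⟩
  rw [← h]
  exact (IntermediateField.equivMap _ L.val).toLinearEquiv.finrank_eq.symm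

/-- The subfield fixed by an automorphism. -/
noncomputable def fixedBy (τ : Ω ≃ₐ[K] Ω) : IntermediateField K Ω :=
  IntermediateField.fixedField (Subgroup.zpowers τ)

theorem mem_fixedBy {τ : Ω ≃ₐ[K] Ω} {z : Ω} : z ∈ fixedBy τ ↔ τ z = z := by
  rw [fixedBy, IntermediateField.mem_fixedField_iff]
  refine ⟨fun h => h τ (Subgroup.mem_zpowers τ), fun h σ hσ => ?_⟩
  have : Subgroup.zpowers τ ≤ MulAction.stabilizer (Ω ≃ₐ[K] Ω) z :=
    Subgroup.zpowers_le.mpr h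
  exact this hσ

variable [Normal K Ω] {L : IntermediateField K Ω}

theorem pow_mem_galInter {M : IntermediateField K Ω} {n : ℕ}
    (h : ∀ τ : Ω ≃ₐ[K] Ω, M ≤ fixedBy (τ ^ n)) (σ : SubfieldGal L) : σ ^ n ∈ galInter L M := by
  refine mem_galInter.mpr fun x hx => Subtype.ext ?_
  have hl (k : ℕ) (y : L) : ((σ.liftNormal Ω) ^ k) (y : Ω) = ((σ ^ k) y : L) := by
    induction k generalizing y with
    | zero => rfl
    | succ k ih =>
      rw [pow_succ, AlgEquiv.mul_apply, pow_succ, AlgEquiv.mul_apply, ← ih]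
      exact congrArg _ (AlgEquiv.liftNormal_commutes σ Ω y)
  rw [← hl, mem_fixedBy.mp (h _ hx)]

/-- Since `M` need not lie in `L`, automorphisms of `L` are lifted to `Ω` and then restricted to
`M`, where they commute. -/
theorem commutator_le_galInter (M : IntermediateField K Ω) [IsAbelianGalois K M] :
    commutator (SubfieldGal L) ≤ galInter L M := by
  have key (σ τ : SubfieldGal L) (x : L) (hx : (x : Ω) ∈ M) : σ (τ x) = τ (σ x) := by
    let s := σ.liftNormal Ω
    let t := τ.liftNormal Ω
    have hs (y : L) : s y = σ y := AlgEquiv.liftNormal_commutes σ Ω y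
    have ht (y : L) : t y = τ y := AlgEquiv.liftNormal_commutes τ Ω y
    have hs' (y : M) : (s.restrictNormal M y : Ω) = s y := AlgEquiv.restrictNormal_commutes s M y
    have ht' (y : M) : (t.restrictNormal M y : Ω) = t y := AlgEquiv.restrictNormal_commutes t M y
    have hc : s.restrictNormal M * t.restrictNormal M = t.restrictNormal M * s.restrictNormal M :=
      mul_comm' _ _
    have h := congrArg Subtype.val (AlgEquiv.congr_fun hc ⟨x, hx⟩)
    rw [AlgEquiv.mul_apply, AlgEquiv.mul_apply, hs', ht', ht', hs'] at h
    apply Subtype.ext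
    rw [← hs, ← ht, ← ht, ← hs]
    exact h
  rw [commutator_def, Subgroup.commutator_le]
  rintro σ - τ -
  refine mem_galInter.mpr fun x hx => ?_
  rw [commutatorElement_def, AlgEquiv.mul_apply, AlgEquiv.mul_apply, AlgEquiv.mul_apply,
    key σ⁻¹ τ⁻¹ x hx, ← AlgEquiv.mul_apply τ, mul_inv_cancel, AlgEquiv.one_apply,
    ← AlgEquiv.mul_apply, mul_inv_cancel, AlgEquiv.one_apply]

/-- The images of `z` under `τ⁰, …, τ³` are among at most three roots, so two coincide and a power
`τ^k` with `k ∈ {1, 2, 3}` fixes `z`; each such `k` divides 6. -/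
theorem pow_six_fixes_root {τ : Ω ≃ₐ[K] Ω} {p : Polynomial K} (hp0 : p ≠ 0)
    (hp : p.natDegree ≤ 3) {z : Ω} (hz : Polynomial.aeval z p = 0) : (τ ^ 6) z = z := by
  classical
  have hroot (k : ℕ) : (τ ^ k) z ∈ (p.rootSet Ω) := by
    rw [Polynomial.mem_rootSet]
    refine ⟨hp0, ?_⟩
    have := Polynomial.aeval_algHom_apply (τ ^ k : Ω ≃ₐ[K] Ω) z p
    rw [this, hz, map_zero]
  have hcard : Fintype.card (p.rootSet Ω) < Fintype.card (Fin 4) := by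
    have h1 : Fintype.card (p.rootSet Ω) ≤ p.natDegree := by
      rw [← Set.toFinset_card]
      have : (p.rootSet Ω).toFinset = (p.aroots Ω).toFinset := by
        ext; rw [Set.mem_toFinset, Multiset.mem_toFinset, Polynomial.mem_rootSet, Polynomial.mem_aroots]
      rw [this]
      refine (Multiset.toFinset_card_le _).trans ((Polynomial.card_roots' _).trans ?_)
      exact Polynomial.natDegree_map_le
    rw [Fintype.card_fin]
    omega
  obtain ⟨i, j, hij, h⟩ := Fintype.exists_ne_map_eq_of_card_lt
    (fun k : Fin 4 => (⟨(τ ^ (k : ℕ)) z, hroot k⟩ : p.rootSet Ω)) hcard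
  have h' : (τ ^ (i : ℕ)) z = (τ ^ (j : ℕ)) z := congrArg Subtype.val h
  have key {i j : ℕ} (hj : j < 4) (hij : i < j) (h : (τ ^ i) z = (τ ^ j) z) : (τ ^ 6) z = z := by
    have h1 : (τ ^ (j - i)) z = z := by
      apply (τ ^ i).injective
      rw [← AlgEquiv.mul_apply, ← pow_add, Nat.add_sub_cancel' hij.le, h]
    have h2 (k : ℕ) : ((τ ^ (j - i)) ^ k) z = z := by
      induction k with
      | zero => rfl
      | succ k ih => rw [pow_succ, AlgEquiv.mul_apply, h1, ih]
    have h3 : (j - i) ∣ 6 := by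
      have : j - i = 1 ∨ j - i = 2 ∨ j - i = 3 := by omega
      rcases this with h | h | h <;> rw [h] <;> norm_num
    obtain ⟨k, hk⟩ := h3
    rw [hk, pow_mul, h2]
  rcases lt_or_gt_of_ne (fun h => hij (Fin.ext h) : (i : ℕ) ≠ j) with h1 | h1
  · exact key j.2 h1 h'
  · exact key i.2 h1 h'.symm

end GaloisTheory

/-! ### Square roots, valuations and the Gauss sum. -/

section SquareRoots

/-- A square root of a rational number of odd valuation does not lie in a field generated by square
roots of rational numbers of valuation zero. -/
theorem sqrt_notMem_adjoin_finset {Ω : Type*} [Field Ω] [Algebra ℚ Ω] (l : ℕ) [Fact l.Prime]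
    (T : Finset Ω) (hT : ∀ s ∈ T, ∃ d : ℚ, d ≠ 0 ∧ padicValRat l d = 0 ∧ s ^ 2 = algebraMap ℚ Ω d)
    {e : ℚ} (he0 : e ≠ 0) (he : Odd (padicValRat l e)) {z : Ω} (hz : z ^ 2 = algebraMap ℚ Ω e) :
    z ∉ IntermediateField.adjoin ℚ (T : Set Ω) := by
  classical
  induction T using Finset.induction_on generalizing e z with
  | empty =>
    rw [Finset.coe_empty, IntermediateField.adjoin_empty, IntermediateField.mem_bot]
    rintro ⟨q, rfl⟩
    have h1 : q ^ 2 = e := (algebraMap ℚ Ω).injective (by rw [map_pow, hz])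
    rw [← h1, padicValRat.pow] at he
    exact (Int.not_even_iff_odd.mpr he) (by simp)
  | insert s T hs ih =>
    have hT' : ∀ s ∈ T, ∃ d : ℚ, d ≠ 0 ∧ padicValRat l d = 0 ∧ s ^ 2 = algebraMap ℚ Ω d :=
      fun t ht => hT t (Finset.mem_insert_of_mem ht)
    obtain ⟨d, hd0, hd, hsd⟩ := hT s (Finset.mem_insert_self _ _)
    set F := IntermediateField.adjoin ℚ (T : Set Ω) with hF
    have hdF : s ^ 2 ∈ F := hsd ▸ F.algebraMap_mem d
    have hrep : ∀ w ∈ IntermediateField.adjoin ℚ ((insert s T : Finset Ω) : Set Ω),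
        ∃ a ∈ F, ∃ b ∈ F, w = a + b * s := by
      intro w hw
      induction hw using IntermediateField.adjoin_induction with
      | mem x hx =>
        rw [Finset.coe_insert] at hx
        rcases hx with rfl | hx
        · exact ⟨0, zero_mem _, 1, one_mem _, by ring⟩
        · exact ⟨x, IntermediateField.subset_adjoin _ _ hx, 0, zero_mem _, by ring⟩
      | algebraMap x => exact ⟨_, F.algebraMap_mem x, 0, zero_mem _, by ring⟩
      | add x y _ _ hx hy =>
        obtain ⟨a, ha, b, hb, rfl⟩ := hx
        obtain ⟨a', ha', b', hb', rfl⟩ := hy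
        exact ⟨_, add_mem ha ha', _, add_mem hb hb', by ring⟩
      | mul x y _ _ hx hy =>
        obtain ⟨a, ha, b, hb, rfl⟩ := hx
        obtain ⟨a', ha', b', hb', rfl⟩ := hy
        exact ⟨_, add_mem (mul_mem ha ha') (mul_mem (mul_mem hb hb') hdF), _,
          add_mem (mul_mem ha hb') (mul_mem hb ha'), by ring⟩
      | inv x _ hx =>
        obtain ⟨a, ha, b, hb, rfl⟩ := hx
        -- It is not assumed that `s ∉ F`, so the conjugate may vanish; the element is then `2a`.
        by_cases h1 : a - b * s = 0
        · refine ⟨(a + a)⁻¹, inv_mem (add_mem ha ha), 0, zero_mem _, ?_⟩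
          rw [← sub_eq_zero.mp h1]; ring
        by_cases h2 : a + b * s = 0
        · exact ⟨0, zero_mem _, 0, zero_mem _, by rw [h2]; simp⟩
        · have hn : (a + b * s) * (a - b * s) = a ^ 2 - b ^ 2 * s ^ 2 := by ring
          have hm : a ^ 2 - b ^ 2 * s ^ 2 ∈ F := sub_mem (pow_mem ha 2) (mul_mem (pow_mem hb 2) hdF)
          refine ⟨_, mul_mem ha (inv_mem hm), _, mul_mem (neg_mem hb) (inv_mem hm), ?_⟩
          rw [← hn]
          field_simp
          ring
    intro hzm
    obtain ⟨a, ha, b, hb, hab⟩ := hrep z hzm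
    have hs0 : s ≠ 0 := by
      rintro rfl
      rw [zero_pow two_ne_zero] at hsd
      exact hd0 ((algebraMap ℚ Ω).injective (by rw [← hsd, map_zero]))
    -- If `z = b s`, then `z s ∈ F` is a square root of `e d`, again of odd valuation; hence the
    -- induction over all `e`. If `a` and `b` are non-zero, squaring `z = a + b s` solves for `s` in
    -- `F`, so `z ∈ F`.
    by_cases ha0 : a = 0
    · refine ih hT' (e := e * d) (z := z * s) (mul_ne_zero he0 hd0) ?_ ?_ ?_
      · rwa [padicValRat.mul he0 hd0, hd, add_zero]
      · rw [mul_pow, hz, hsd, map_mul]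
      · rw [hab, ha0, zero_add, mul_assoc, ← pow_two]
        exact mul_mem hb hdF
    · refine ih hT' he0 he hz ?_
      by_cases hb0 : b = 0
      · rw [hab, hb0, zero_mul, add_zero]; exact ha
      have h2 : (2 : Ω) ≠ 0 := by
        have : (algebraMap ℚ Ω) 2 ≠ 0 := (map_ne_zero _).mpr two_ne_zero
        simpa using this
      have h : s = (z ^ 2 - a ^ 2 - b ^ 2 * s ^ 2) * (2 * a * b)⁻¹ := by
        rw [hab]; field_simp; ring
      have hsF : s ∈ F := by
        rw [h, hz]
        refine mul_mem (sub_mem (sub_mem (F.algebraMap_mem e) (pow_mem ha 2))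
          (mul_mem (pow_mem hb 2) hdF)) (inv_mem (mul_mem (mul_mem ?_ ha) hb))
        simp
      rw [hab]
      exact add_mem ha (mul_mem hb hsF)

theorem sqrt_notMem_adjoin {Ω : Type*} [Field Ω] [Algebra ℚ Ω] (l : ℕ) [Fact l.Prime] (S : Set Ω)
    (hS : ∀ s ∈ S, ∃ d : ℚ, d ≠ 0 ∧ padicValRat l d = 0 ∧ s ^ 2 = algebraMap ℚ Ω d)
    {e : ℚ} (he0 : e ≠ 0) (he : Odd (padicValRat l e)) {z : Ω} (hz : z ^ 2 = algebraMap ℚ Ω e) :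
    z ∉ IntermediateField.adjoin ℚ S := by
  intro h
  obtain ⟨T, hTS, hT⟩ := IntermediateField.exists_finset_of_mem_adjoin h
  exact sqrt_notMem_adjoin_finset l T (fun s hs => hS s (hTS hs)) he0 he hz hT

/-- The quadratic Gauss sum. -/
theorem exists_sq_eq_of_isPrimitiveRoot {Ω : Type*} [Field Ω] [CharZero Ω] {l : ℕ} [Fact l.Prime]
    (hl : l ≠ 2) {ζ : Ω} (hζ : IsPrimitiveRoot ζ l) :
    ∃ g ∈ Subring.closure {ζ}, g ^ 2 = l ∨ g ^ 2 = -l := by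
  have hc : ringChar (ZMod l) ≠ 2 := by rwa [ZMod.ringChar_zmod_n]
  let χ : MulChar (ZMod l) Ω := (quadraticChar (ZMod l)).ringHomComp (Int.castRingHom Ω)
  have hχ1 : χ ≠ 1 := by
    obtain ⟨a, ha⟩ := quadraticChar_exists_neg_one' hc
    intro h
    have h1 := congrArg (fun c : MulChar (ZMod l) Ω => c a) h
    simp only [χ, MulChar.ringHomComp_apply, ha, MulChar.one_apply_coe] at h1
    norm_num at h1
  have hχ2 : χ.IsQuadratic := (quadraticChar_isQuadratic (ZMod l)).comp _
  let ψ : AddChar (ZMod l) Ω := AddChar.zmodChar l hζ.pow_eq_one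
  have hψ : ψ.IsPrimitive := AddChar.zmodChar_primitive_of_primitive_root l hζ
  have hsq := gaussSum_sq hχ1 hχ2 hψ
  rw [ZMod.card] at hsq
  refine ⟨gaussSum χ ψ, ?_, ?_⟩
  · rw [gaussSum]
    refine sum_mem fun a _ => mul_mem ?_ ?_
    · rw [MulChar.ringHomComp_apply]
      exact intCast_mem _ _
    · rw [AddChar.zmodChar_apply]
      exact Subring.pow_mem _ (Subring.subset_closure (Set.mem_singleton ζ)) _
  · rw [hsq]
    have h1 : (-1 : ZMod l) ≠ 0 := neg_ne_zero.mpr one_ne_zero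
    rw [MulChar.ringHomComp_apply]
    rcases quadraticChar_dichotomy h1 with h | h <;> rw [h] <;> simp

end SquareRoots

/-! ### The division field, its Galois action and its roots of unity. -/

section DivisionField

open WeierstrassCurve.Affine

theorem shortCurve_isElliptic {A B : ℤ} (h : 4 * A ^ 3 + 27 * B ^ 2 ≠ 0) :
    (shortCurve A B).IsElliptic := by
  refine ⟨isUnit_iff_ne_zero.mpr ?_⟩
  have h1 : (shortCurve A B).Δ = -16 * ((4 * A ^ 3 + 27 * B ^ 2 : ℤ) : ℚ) := by
    simp only [shortCurve, WeierstrassCurve.Δ, WeierstrassCurve.b₂, WeierstrassCurve.b₄,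
      WeierstrassCurve.b₆, WeierstrassCurve.b₈]
    push_cast
    ring
  rw [h1]
  exact mul_ne_zero (by norm_num) (by exact_mod_cast h)

variable {W : WeierstrassCurve ℚ} {l : ℕ}

theorem map_mem_ellTorsion (σ : QBar →ₐ[ℚ] QBar) {P : GeomPoint W} (hP : P ∈ ellTorsion W l) :
    Point.map (W' := W) σ P ∈ ellTorsion W l := by
  rw [AddSubgroup.torsionBy.nsmul_iff] at hP ⊢
  rw [← map_nsmul, hP, map_zero]

instance normal_divisionField :
    @Normal ℚ (divisionField W l) _ _ (IntermediateField.algebra' _) := by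
  rw [IntermediateField.normal_iff_forall_map_le]
  intro σ
  unfold divisionField
  rw [IntermediateField.adjoin_map, IntermediateField.adjoin_le_iff]
  rintro _ ⟨z, ⟨x, y, h, hP, hz⟩, rfl⟩
  have h1 := map_mem_ellTorsion σ hP
  rw [Point.map_some] at h1
  refine IntermediateField.subset_adjoin _ _ ⟨_, _, _, h1, ?_⟩
  rcases hz with rfl | rfl
  · exact Or.inl rfl
  · exact Or.inr rfl

instance isGalois_divisionField :
    @IsGalois ℚ _ (divisionField W l) _ (IntermediateField.algebra' _) :=
  @IsGalois.mk _ _ _ _ _ inferInstance normal_divisionField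

theorem galAct_injective : Function.Injective (galAct W l) := by
  rw [injective_iff_map_eq_one]
  intro s hs
  have h1 : divisionField W l ≤ fixedBy (s.liftNormal QBar) := by
    unfold divisionField
    rw [IntermediateField.adjoin_le_iff]
    rintro z ⟨x, y, h, hP, hz⟩
    have h2 := congrArg Subtype.val (LinearMap.congr_fun hs ⟨_, hP⟩)
    change Point.map (W' := W) (s.liftNormal QBar).toAlgHom (Point.some x y h) = Point.some x y h at h2
    rw [Point.map_some, Point.some.injEq] at h2
    refine mem_fixedBy.mpr ?_
    rcases hz with rfl | rfl
    · exact h2.1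
    · exact h2.2
  refine AlgEquiv.ext fun x => Subtype.ext ?_
  have h3 := AlgEquiv.liftNormal_commutes s QBar x
  exact h3.symm.trans (mem_fixedBy.mp (h1 x.2))

theorem map_eq_self_of_le_fixedBy {σ : QBar ≃ₐ[ℚ] QBar} (h : divisionField W l ≤ fixedBy σ)
    {P : GeomPoint W} (hP : P ∈ ellTorsion W l) : Point.map (W' := W) σ.toAlgHom P = P := by
  rcases P with _ | ⟨x, y, hxy⟩
  · rfl
  · rw [Point.map_some, Point.some.injEq]
    exact ⟨mem_fixedBy.mp (h (IntermediateField.subset_adjoin _ _ ⟨x, y, hxy, hP, Or.inl rfl⟩)),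
      mem_fixedBy.mp (h (IntermediateField.subset_adjoin _ _ ⟨x, y, hxy, hP, Or.inr rfl⟩))⟩

variable [Fact l.Prime]

/-- If the Galois group of the division field is not commutative, then the torsion contains a plane. -/
theorem exists_plane (hG : ∃ s t : DivGal W l, s * t ≠ t * s) :
    ∃ G : AddSubgroup (GeomPoint W), Finite G ∧ G ≤ ellTorsion W l ∧ Nat.card G = l ^ 2 := by
  -- If one vector spanned the torsion, the faithful Galois action would be by scalars and the group
  -- commutative.
  have hdim (v : ellTorsion W l) : ∃ w : ellTorsion W l, ∀ c : ZMod l, c • v ≠ w := by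
    by_contra! hv
    obtain ⟨s, t, hst⟩ := hG
    refine hst (galAct_injective (LinearMap.ext fun w => ?_))
    obtain ⟨a, ha⟩ := hv (galAct W l s v)
    obtain ⟨b, hb⟩ := hv (galAct W l t v)
    obtain ⟨c, rfl⟩ := hv w
    rw [map_mul, map_mul, Module.End.mul_apply, Module.End.mul_apply]
    simp only [map_smul, ← ha, ← hb]
    rw [smul_comm a b]
  obtain ⟨v, hv⟩ := hdim 0
  obtain ⟨w, hw⟩ := hdim v
  have hv0 : v ≠ 0 := fun h => hv 0 (by rw [h, smul_zero])
  let f : (ZMod l × ZMod l) →ₗ[ZMod l] ellTorsion W l :=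
    (LinearMap.toSpanSingleton (ZMod l) _ v).coprod (LinearMap.toSpanSingleton (ZMod l) _ w)
  have hf : Function.Injective f := by
    rw [injective_iff_map_eq_zero]
    rintro ⟨a, b⟩ hab
    have hab' : a • v + b • w = 0 := by simpa [f] using hab
    have hb : b = 0 := by
      by_contra hb
      refine hw (-(b⁻¹ * a)) ?_
      have := congrArg (b⁻¹ • ·) hab'
      simp only [smul_add, smul_smul, inv_mul_cancel₀ hb, one_smul, smul_zero] at this
      rw [neg_smul]
      exact neg_eq_of_add_eq_zero_right this
    rw [hb, zero_smul, add_zero] at hab'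
    rw [hb, (smul_eq_zero.mp hab').resolve_right hv0]
    rfl
  let g : (ZMod l × ZMod l) →+ GeomPoint W := (ellTorsion W l).subtype.comp f.toAddMonoidHom
  have hg : Function.Injective g := Subtype.val_injective.comp hf
  refine ⟨g.range, inferInstance, ?_, ?_⟩
  · rintro _ ⟨x, rfl⟩
    exact (f x).2
  · rw [← Nat.card_congr (AddMonoidHom.ofInjective hg).toEquiv, Nat.card_prod, Nat.card_zmod,
      pow_two]

/-- A plane of torsion points has `l²` elements, and `l² > 2l + 2` holds from `l = 3` on. The
resulting pairing value is fixed by every automorphism over the division field, so it lies there. -/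
theorem exists_isPrimitiveRoot_mem_divisionField [W.IsElliptic] (hl : 3 ≤ l)
    (hG : ∃ s t : DivGal W l, s * t ≠ t * s) : ∃ ζ ∈ divisionField W l, IsPrimitiveRoot ζ l := by
  have hp : l.Prime := Fact.out
  obtain ⟨G, hfin, hGl, hcard⟩ := exists_plane hG
  have hell : (W.baseChange QBar).IsElliptic :=
    inferInstanceAs (W.map (algebraMap ℚ QBar)).IsElliptic
  have h1 : ∀ P ∈ G, l • P = 0 := fun P hP => AddSubgroup.torsionBy.nsmul_iff.mp (hGl hP)
  obtain ⟨ζ, hζ1, hζl, hζ⟩ := Point.exists_pow_eq_one_of_torsion (K := QBar)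
    (W := (W.baseChange QBar).toAffine) (G := G) (n := l)
    (hp.odd_of_ne_two (by omega)) h1 (by rw [hcard]; nlinarith)
  refine ⟨ζ, ?_, orderOf_eq_prime hζl hζ1 ▸ IsPrimitiveRoot.orderOf ζ⟩
  rw [← InfiniteGalois.fixedField_fixingSubgroup (divisionField W l),
    IntermediateField.mem_fixedField_iff]
  intro σ hσ
  have hσ' : divisionField W l ≤ fixedBy σ := fun z hz => mem_fixedBy.mpr (hσ ⟨z, hz⟩)
  refine hζ (σ : QBar →+* QBar) (Point.map (W' := W) σ.toAlgHom) ?_ (fun x y h => ⟨_, rfl⟩)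
    fun P hP => map_eq_self_of_le_fixedBy hσ' (hGl hP)
  change (W.map (algebraMap ℚ QBar)).map (σ : QBar →+* QBar) = W.map (algebraMap ℚ QBar)
  rw [WeierstrassCurve.map_map, Subsingleton.elim ((σ : QBar →+* QBar).comp _) (algebraMap ℚ QBar)]

theorem cycloField_eq_adjoin {ζ : QBar} (hζ : IsPrimitiveRoot ζ l) :
    cycloField l = IntermediateField.adjoin ℚ {ζ} := by
  have hl : 0 < l := (Fact.out : l.Prime).pos
  have : NeZero l := ⟨hl.ne'⟩
  apply le_antisymm
  · rw [cycloField, IntermediateField.adjoin_le_iff]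
    intro z hz
    obtain ⟨i, -, rfl⟩ := hζ.eq_pow_of_pow_eq_one hz
    exact pow_mem (IntermediateField.mem_adjoin_simple_self ℚ ζ) i
  · rw [IntermediateField.adjoin_le_iff, Set.singleton_subset_iff]
    exact IntermediateField.subset_adjoin _ _ hζ.pow_eq_one

theorem isCyclotomicExtension_cycloField {ζ : QBar} (hζ : IsPrimitiveRoot ζ l) :
    IsCyclotomicExtension {l} ℚ (cycloField l) := by
  have : NeZero l := ⟨(Fact.out : l.Prime).ne_zero⟩
  rw [cycloField_eq_adjoin hζ]
  exact hζ.intermediateField_adjoin_isCyclotomicExtension ℚ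

theorem finrank_cycloField {ζ : QBar} (hζ : IsPrimitiveRoot ζ l) :
    Module.finrank ℚ (cycloField l) = l - 1 := by
  have hp : l.Prime := Fact.out
  have : NeZero l := ⟨hp.ne_zero⟩
  have := isCyclotomicExtension_cycloField hζ
  rw [IsCyclotomicExtension.finrank (n := l) (cycloField l)
    (Polynomial.cyclotomic.irreducible_rat hp.pos), Nat.totient_prime hp]

theorem isAbelianGalois_cycloField {ζ : QBar} (hζ : IsPrimitiveRoot ζ l) :
    IsAbelianGalois ℚ (cycloField l) := by
  have := isCyclotomicExtension_cycloField hζ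
  exact IsCyclotomicExtension.isAbelianGalois {l} ℚ _

theorem rhoTilde_injective (b : Module.Basis (Fin 2) (ZMod l) (ellTorsion W l)) :
    Function.Injective (rhoTilde W l b) := by
  intro s t h
  have h1 := congrArg Units.val h
  exact galAct_injective ((LinearMap.toMatrixAlgEquiv b).injective h1)

/-- The given isomorphism is abstract and unrelated to the action; it supplies only the group order,
which makes the injective representation surjective. -/
theorem rhoTilde_bijective (hGL : Nonempty (DivGal W l ≃* GL (Fin 2) (ZMod l)))
    (b : Module.Basis (Fin 2) (ZMod l) (ellTorsion W l)) :
    Function.Bijective (rhoTilde W l b) := by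
  obtain ⟨e⟩ := hGL
  have : Finite (DivGal W l) := Finite.of_equiv _ e.symm.toEquiv
  exact (Nat.bijective_iff_injective_and_card _).mpr
    ⟨rhoTilde_injective b, Nat.card_congr e.toEquiv⟩

theorem galAct_apply_basis (b : Module.Basis (Fin 2) (ZMod l) (ellTorsion W l)) (s : DivGal W l)
    (j : Fin 2) : galAct W l s (b j) =
      (rhoTilde W l b s : Matrix (Fin 2) (Fin 2) (ZMod l)) 0 j • b 0 +
        (rhoTilde W l b s : Matrix (Fin 2) (Fin 2) (ZMod l)) 1 j • b 1 := by
  have h : galAct W l s = Matrix.toLin b b (rhoTilde W l b s : Matrix (Fin 2) (Fin 2) (ZMod l)) :=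
    (Matrix.toLin_toMatrix b b _).symm
  nth_rw 1 [h]
  rw [Matrix.toLin_self, Fin.sum_univ_two]

end DivisionField

/-! ### The fields `K₂`, `K₃` and `K'`. -/

section Multiquadratic

theorem sq_fixes_of_sq_eq {K Ω : Type} [Field K] [Field Ω] [Algebra K Ω] (τ : Ω ≃ₐ[K] Ω) {z : Ω}
    {d : K} (hz : z ^ 2 = algebraMap K Ω d) : (τ ^ 2) z = z := by
  have h : τ z ^ 2 = z ^ 2 := by rw [← map_pow, hz, AlgEquiv.commutes]
  rw [pow_two, AlgEquiv.mul_apply]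
  rcases sq_eq_sq_iff_eq_or_eq_neg.mp h with h | h
  · rw [h, h]
  · rw [h, map_neg, h, neg_neg]

variable {l : ℕ} {C : ℝ}

/-- Fourth roots of unity are square roots of `±1`, so every generator is a square root of an
`l`-adic unit. -/
theorem exists_fieldK2_eq_adjoin (l : ℕ) [Fact l.Prime] (C : ℝ) :
    ∃ S : Set QBar, fieldK2 l C = IntermediateField.adjoin ℚ S ∧
      ∀ s ∈ S, ∃ d : ℚ, d ≠ 0 ∧ padicValRat l d = 0 ∧ s ^ 2 = algebraMap ℚ QBar d := by
  refine ⟨_, (IntermediateField.adjoin_union ..).symm, ?_⟩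
  rintro s (hs | ⟨p, hp, hpl, -, hs⟩)
  · have hs' : (s ^ 2 - 1) * (s ^ 2 + 1) = 0 := by
      have : s ^ 4 = 1 := hs
      linear_combination this
    rcases mul_eq_zero.mp hs' with h | h
    · exact ⟨1, one_ne_zero, by simp, by rw [map_one]; linear_combination h⟩
    · exact ⟨-1, by norm_num, by simp, by rw [map_neg, map_one]; linear_combination h⟩
  · have : Fact p.Prime := ⟨hp⟩
    refine ⟨p, by exact_mod_cast hp.ne_zero, ?_, by rw [hs, map_natCast]⟩
    rw [padicValRat.of_nat, padicValNat_primes (Ne.symm hpl), Nat.cast_zero]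

theorem fieldK3_le_fixedBy_sq [Fact l.Prime] (τ : QBar ≃ₐ[ℚ] QBar) :
    fieldK3 l C ≤ fixedBy (τ ^ 2) := by
  obtain ⟨S, hS, hS'⟩ := exists_fieldK2_eq_adjoin l C
  unfold fieldK3
  rw [hS]
  refine sup_le (IntermediateField.adjoin_le_iff.mpr fun z hz => mem_fixedBy.mpr ?_)
    (IntermediateField.adjoin_le_iff.mpr fun z hz => mem_fixedBy.mpr ?_)
  · obtain ⟨d, -, -, hd⟩ := hS' z hz
    exact sq_fixes_of_sq_eq τ hd
  · refine sq_fixes_of_sq_eq τ (d := (l : ℚ)) ?_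
    rw [map_natCast]
    exact hz

theorem fieldK2_le_fieldK3 : fieldK2 l C ≤ fieldK3 l C := le_sup_left

theorem galOver_fieldK3_le_fieldK2 {W : WeierstrassCurve ℚ} :
    galOver W l (fieldK3 l C) ≤ galOver W l (fieldK2 l C) := fun _ hs =>
  mem_galInter.mpr fun x hx => mem_galInter.mp hs x (fieldK2_le_fieldK3 hx)

theorem fieldK'_le_fixedBy_pow_six [Fact l.Prime] {A B : ℤ} (τ : QBar ≃ₐ[ℚ] QBar) :
    fieldK' A B l C ≤ fixedBy (τ ^ 6) := by
  have h3 : fieldK3 l C ≤ fixedBy (τ ^ 6) := by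
    rw [show τ ^ 6 = (τ ^ 3) ^ 2 by rw [← pow_mul]]
    exact fieldK3_le_fixedBy_sq _
  refine sup_le h3 (iSup₂_le fun u _ => sup_le h3 ?_)
  refine IntermediateField.adjoin_le_iff.mpr fun z hz => mem_fixedBy.mpr ?_
  let p : Polynomial ℚ := Polynomial.X ^ 3 +
    (Polynomial.C (A : ℚ) * Polynomial.X + Polynomial.C ((B : ℚ) - u))
  have hdeg : p.natDegree = 3 := by
    simp only [p]
    compute_degree!
  refine pow_six_fixes_root (p := p) (fun h => ?_) hdeg.le ?_
  · rw [h, Polynomial.natDegree_zero] at hdeg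
    exact absurd hdeg (by norm_num)
  · have hz' : z ^ 3 + (A : QBar) * z + (B : QBar) = algebraMap ℚ QBar u := hz
    simp only [p, map_add, map_pow, Polynomial.aeval_X, map_mul, Polynomial.aeval_C, map_sub,
      map_intCast]
    linear_combination hz'

theorem sqrt_notMem_fieldK2 [Fact l.Prime] {z : QBar} (hz : z ^ 2 = l ∨ z ^ 2 = -l) :
    z ∉ fieldK2 l C := by
  have hp : l.Prime := Fact.out
  obtain ⟨S, hS, hS'⟩ := exists_fieldK2_eq_adjoin l C
  rw [hS]
  have h0 : (l : ℚ) ≠ 0 := by exact_mod_cast hp.ne_zero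
  rcases hz with hz | hz
  · refine sqrt_notMem_adjoin l S hS' h0 ?_ (by rw [hz, map_natCast])
    rw [padicValRat.self hp.one_lt]
    exact odd_one
  · refine sqrt_notMem_adjoin l S hS' (neg_ne_zero.mpr h0) ?_ (by rw [hz, map_neg, map_natCast])
    rw [padicValRat.neg, padicValRat.self hp.one_lt]
    exact odd_one

/-- The sign of the squared Gauss sum does not matter because `ℚ(μ₄)` contains a square root of
`-1`. -/
theorem sqrt_mem_fieldK3 {z : QBar} (hz : z ^ 2 = l ∨ z ^ 2 = -l) : z ∈ fieldK3 l C := by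
  have h3 (w : QBar) (hw : w ^ 2 = l) : w ∈ fieldK3 l C :=
    (le_sup_right : _ ≤ fieldK3 l C) (IntermediateField.subset_adjoin _ _ hw)
  rcases hz with hz | hz
  · exact h3 z hz
  · obtain ⟨i, hi⟩ := IsAlgClosed.exists_pow_nat_eq (-1 : QBar) two_pos
    have hi4 : i ∈ cycloField 4 := IntermediateField.subset_adjoin _ _
      (show i ^ 4 = 1 by linear_combination (i ^ 2 - 1) * hi)
    have hi3 : i ∈ fieldK3 l C := fieldK2_le_fieldK3 ((le_sup_left : _ ≤ fieldK2 l C) hi4)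
    have h := mul_mem (neg_mem hi3) (h3 (i * z) (by linear_combination z ^ 2 * hi - hz))
    rwa [show -i * (i * z) = z by linear_combination -z * hi] at h

end Multiquadratic

/-! ### Subgroups of the Galois group read in `GL₂(𝔽_ℓ)`. -/

section GaloisImage

open Matrix Matrix.SpecialLinearGroup

variable {W : WeierstrassCurve ℚ} {l : ℕ} [Fact l.Prime]

theorem two_ne_zero_zmod (hl : 5 ≤ l) : (2 : ZMod l) ≠ 0 := by
  intro h
  have h1 : ((2 : ℕ) : ZMod l) = 0 := by exact_mod_cast h
  rw [ZMod.natCast_eq_zero_iff] at h1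
  have := Nat.le_of_dvd two_pos h1
  omega

theorem three_ne_zero_zmod (hl : 5 ≤ l) : (3 : ZMod l) ≠ 0 := by
  intro h
  have h1 : ((3 : ℕ) : ZMod l) = 0 := by exact_mod_cast h
  rw [ZMod.natCast_eq_zero_iff] at h1
  have := Nat.le_of_dvd three_pos h1
  omega

theorem two_sq_ne_one_zmod (hl : 5 ≤ l) : (2 : ZMod l) ^ 2 ≠ 1 := fun h =>
  three_ne_zero_zmod hl (by linear_combination h)

theorem six_ne_zero_zmod (hl : 5 ≤ l) : ((6 : ℕ) : ZMod l) ≠ 0 := by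
  have h := mul_ne_zero (two_ne_zero_zmod hl) (three_ne_zero_zmod hl)
  norm_num at h ⊢
  exact h

theorem natCard_units_zmod (l : ℕ) [Fact l.Prime] : Nat.card (ZMod l)ˣ = l - 1 := by
  rw [Nat.card_eq_fintype_card, ZMod.card_units]

theorem exists_mul_ne_mul_of_mulEquiv {G F : Type*} [Group G] [Field F] (e : G ≃* GL (Fin 2) F) :
    ∃ s t : G, s * t ≠ t * s := by
  let u : SpecialLinearGroup (Fin 2) F := ⟨!![1, 1; 0, 1], by simp [det_fin_two]⟩
  let v : SpecialLinearGroup (Fin 2) F := ⟨!![1, 0; 1, 1], by simp [det_fin_two]⟩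
  refine ⟨e.symm (toGL u), e.symm (toGL v), fun h => ?_⟩
  rw [← map_mul, ← map_mul, ← map_mul, ← map_mul, e.symm.injective.eq_iff] at h
  have h1 := congrArg (fun g : GL (Fin 2) F => (g : Matrix (Fin 2) (Fin 2) F) 0 0) h
  change (!![1, 1; 0, 1] * !![1, 0; 1, 1] : Matrix (Fin 2) (Fin 2) F) 0 0 =
    (!![1, 0; 1, 1] * !![1, 1; 0, 1] : Matrix (Fin 2) (Fin 2) F) 0 0 at h1
  simp at h1

/-- The commutator subgroup acts trivially on an abelian field, and both subgroups have index `l -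
1`. -/
theorem galOver_cycloField (hl : 5 ≤ l) (e : DivGal W l ≃* GL (Fin 2) (ZMod l)) {ζ : QBar}
    (hζ : IsPrimitiveRoot ζ l) (hc : cycloField l ≤ divisionField W l) :
    galOver W l (cycloField l) = commutator (DivGal W l) := by
  have : Finite (DivGal W l) := Finite.of_equiv _ e.symm.toEquiv
  have hab : IsAbelianSubext (cycloField l) := isAbelianGalois_cycloField hζ
  have hle : commutator (DivGal W l) ≤ galOver W l (cycloField l) :=
    @commutator_le_galInter _ _ _ _ _ _ _ (cycloField l) hab
  refine (Subgroup.eq_of_le_of_card_ge hle ?_).symm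
  have h1 : (galOver W l (cycloField l)).index = l - 1 := by
    rw [galOver, ← finrank_inf_eq_index_galInter, inf_eq_right.mpr hc, finrank_cycloField hζ]
  have h2 := index_commutator e (two_ne_zero_zmod hl) (two_sq_ne_one_zmod hl)
  rw [natCard_units_zmod] at h2
  have h3 := Subgroup.card_mul_index (galOver W l (cycloField l))
  rw [← Subgroup.card_mul_index (commutator (DivGal W l)), h1, h2] at h3
  exact (Nat.eq_of_mul_eq_mul_right (by omega) h3).le

theorem isGreatest_cycloField (hl : 5 ≤ l) (e : DivGal W l ≃* GL (Fin 2) (ZMod l)) {ζ : QBar}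
    (hζ : IsPrimitiveRoot ζ l) (hc : cycloField l ≤ divisionField W l) :
    IsGreatest {M : IntermediateField ℚ QBar | M ≤ divisionField W l ∧ IsAbelianSubext M}
      (cycloField l) := by
  refine ⟨⟨hc, isAbelianGalois_cycloField hζ⟩, fun M hM => ?_⟩
  have h1 : galOver W l (cycloField l) ≤ galOver W l M := by
    rw [galOver_cycloField hl e hζ hc]
    exact @commutator_le_galInter _ _ _ _ _ _ _ M hM.2
  have h2 := inf_le_of_galInter_le h1
  rwa [inf_eq_right.mpr hM.1] at h2

theorem map_rhoTilde_commutator (hl : 5 ≤ l) (b : Module.Basis (Fin 2) (ZMod l) (ellTorsion W l))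
    (hb : Function.Bijective (rhoTilde W l b)) :
    (commutator (DivGal W l)).map (rhoTilde W l b) =
      (toGL : SpecialLinearGroup (Fin 2) (ZMod l) →* _).range := by
  rw [← commutator_GL_two (two_ne_zero_zmod hl) (two_sq_ne_one_zmod hl)]
  exact map_commutator_of_mulEquiv (MulEquiv.ofBijective _ hb)

theorem sq_mem_galOver_fieldK3 {C : ℝ} (s : DivGal W l) : s ^ 2 ∈ galOver W l (fieldK3 l C) :=
  pow_mem_galInter (fun τ => fieldK3_le_fixedBy_sq τ) s

theorem pow_six_mem_galOver_fieldK' {A B : ℤ} {C : ℝ} (s : DivGal W l) :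
    s ^ 6 ∈ galOver W l (fieldK' A B l C) :=
  pow_mem_galInter (fun τ => fieldK'_le_fixedBy_pow_six τ) s

theorem finrank_inf_dvd (hl : 5 ≤ l) (e : DivGal W l ≃* GL (Fin 2) (ZMod l))
    {M : IntermediateField ℚ QBar} {n : ℕ} (hn : (n : ZMod l) ≠ 0)
    (hM : ∀ s : DivGal W l, s ^ n ∈ galOver W l M) :
    Module.finrank ℚ ↥(divisionField W l ⊓ M) ∣ n := by
  rw [finrank_inf_eq_index_galInter]
  exact index_dvd_of_pow_mem e (two_ne_zero_zmod hl) (two_sq_ne_one_zmod hl) _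
    (commutator_le_of_pow_mem e (two_ne_zero_zmod hl) (two_sq_ne_one_zmod hl) hn _ hM) hM

/-- Both degrees divide 2. The Gauss sum lies in the second intersection but not in the first, so
the second has degree 2 and the first, being strictly smaller, degree 1. -/
theorem inf_fieldK2_and_finrank_inf_fieldK3 (hl : 5 ≤ l)
    (e : DivGal W l ≃* GL (Fin 2) (ZMod l)) {ζ : QBar} (hζ : IsPrimitiveRoot ζ l)
    (hL : ζ ∈ divisionField W l) (C : ℝ) :
    divisionField W l ⊓ fieldK2 l C = ⊥ ∧
      Module.finrank ℚ ↥(divisionField W l ⊓ fieldK3 l C) = 2 := by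
  have h2 : ((2 : ℕ) : ZMod l) ≠ 0 := by exact_mod_cast two_ne_zero_zmod hl
  obtain ⟨g, hg, hgl⟩ := exists_sq_eq_of_isPrimitiveRoot (by omega : l ≠ 2) hζ
  have hgL : g ∈ divisionField W l := by
    have : Subring.closure {ζ} ≤ (divisionField W l).toSubring :=
      Subring.closure_le.mpr (Set.singleton_subset_iff.mpr hL)
    exact this hg
  have hd3 := finrank_inf_dvd hl e h2 (sq_mem_galOver_fieldK3 (C := C))
  have hd2 := finrank_inf_dvd hl e h2
    (fun s => galOver_fieldK3_le_fieldK2 (sq_mem_galOver_fieldK3 (C := C) s))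
  have hg3 : g ∈ divisionField W l ⊓ fieldK3 l C := ⟨hgL, sqrt_mem_fieldK3 hgl⟩
  have hg2 : g ∉ divisionField W l ⊓ fieldK2 l C := fun h => sqrt_notMem_fieldK2 hgl h.2
  have h3 : Module.finrank ℚ ↥(divisionField W l ⊓ fieldK3 l C) = 2 := by
    rcases (Nat.dvd_prime Nat.prime_two).mp hd3 with h | h
    · rw [IntermediateField.finrank_eq_one_iff] at h
      rw [h] at hg3
      exact absurd ((bot_le : ⊥ ≤ divisionField W l ⊓ fieldK2 l C) hg3) hg2
    · exact h
  refine ⟨?_, h3⟩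
  rcases (Nat.dvd_prime Nat.prime_two).mp hd2 with h | h
  · exact IntermediateField.finrank_eq_one_iff.mp h
  · have : FiniteDimensional ℚ ↥(divisionField W l ⊓ fieldK3 l C) :=
      FiniteDimensional.of_finrank_pos (by omega)
    have heq := IntermediateField.eq_of_le_of_finrank_eq
      (inf_le_inf_left (divisionField W l) (fieldK2_le_fieldK3 (l := l) (C := C))) (h.trans h3.symm)
    rw [← heq] at hg3
    exact absurd hg3 hg2

/-- The diagonal torus of `GL₂`. -/
def diagGL (F : Type*) [Field F] : Fˣ × Fˣ →* GL (Fin 2) F :=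
  MonoidHom.toHomUnits
    { toFun := fun c => !![(c.1 : F), 0; 0, (c.2 : F)]
      map_one' := by simp [one_fin_two]
      map_mul' := fun c d => by simp }

theorem coe_diagGL {F : Type*} [Field F] (c : Fˣ × Fˣ) :
    (diagGL F c : Matrix (Fin 2) (Fin 2) F) = !![(c.1 : F), 0; 0, (c.2 : F)] := rfl

theorem diagGL_injective (F : Type*) [Field F] : Function.Injective (diagGL F) := by
  intro c d h
  have h1 := congrArg Units.val h
  rw [coe_diagGL, coe_diagGL] at h1
  have h00 := congrFun (congrFun h1 0) 0
  have h11 := congrFun (congrFun h1 1) 1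
  simp only [of_apply, cons_val', cons_val_zero, cons_val_one, cons_val_fin_one] at h00 h11
  exact Prod.ext (Units.ext h00) (Units.ext h11)

theorem mem_galOver_of_rhoTilde_eq_pow {A B : ℤ} {C : ℝ}
    (b : Module.Basis (Fin 2) (ZMod l) (ellTorsion W l))
    (hb : Function.Bijective (rhoTilde W l b)) {s : DivGal W l} {g : GL (Fin 2) (ZMod l)}
    (h : rhoTilde W l b s = g ^ 6) : s ∈ galOver W l (fieldK' A B l C) := by
  obtain ⟨t, rfl⟩ := hb.2 g
  rw [← map_pow] at h
  rw [hb.1 h]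
  exact pow_six_mem_galOver_fieldK' t

theorem exists_pow_six_eq {lam : (ZMod l)ˣ}
    (h : lam ^ ((l - 1) / Nat.gcd (l - 1) 12) = 1) : ∃ c : (ZMod l)ˣ, c ^ 6 = lam := by
  rw [← natCard_units_zmod l] at h
  obtain ⟨d, rfl⟩ := exists_pow_eq_of_pow_card_div_gcd_eq_one h
  -- The order condition makes `lam` a twelfth power; only a sixth power is needed.
  exact ⟨d ^ 2, by rw [← pow_mul]⟩

theorem exists_orderOf_eq {m : ℕ} (hm : m ∣ l - 1) : ∃ c : (ZMod l)ˣ, orderOf c = m := by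
  obtain ⟨g, hg⟩ := IsCyclic.exists_ofOrder_eq_natCard (α := (ZMod l)ˣ)
  rw [natCard_units_zmod] at hg
  have hl : 0 < l - 1 := Nat.sub_pos_of_lt (Fact.out : l.Prime).one_lt
  obtain ⟨k, hk⟩ := hm
  have hk0 : k ≠ 0 := by
    rintro rfl
    omega
  refine ⟨g ^ k, ?_⟩
  rw [orderOf_pow_of_dvd hk0 (by rw [hg, hk]; exact dvd_mul_left _ _), hg, hk,
    Nat.mul_div_cancel _ (Nat.pos_of_ne_zero hk0)]

theorem exists_galOver_diag {A B : ℤ} {C : ℝ}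
    (b : Module.Basis (Fin 2) (ZMod l) (ellTorsion W l))
    (hb : Function.Bijective (rhoTilde W l b)) {d₀ : ℕ}
    (hd : d₀ ∣ (l - 1) / Nat.gcd (l - 1) 12) :
    ∃ σ₀ ∈ galOver W l (fieldK' A B l C), orderOf σ₀ = d₀ ∧
      ∃ lam : (ZMod l)ˣ, orderOf lam = d₀ ∧
        (rhoTilde W l b σ₀ : Matrix (Fin 2) (Fin 2) (ZMod l)) = !![(lam : ZMod l), 0; 0, 1] ∧
        (∀ v ∈ Submodule.span (ZMod l) {b 0}, galAct W l σ₀ v = (lam : ZMod l) • v) ∧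
        (∀ v ∈ Submodule.span (ZMod l) {b 1}, galAct W l σ₀ v = v) := by
  obtain ⟨lam, hlam⟩ := exists_orderOf_eq (l := l)
    (hd.trans (Nat.div_dvd_of_dvd (Nat.gcd_dvd_left _ _)))
  -- With `c⁶ = lam`, the matrix `diag(lam, 1)` is the sixth power of `diag(c, 1)`, hence comes from
  -- the subgroup.
  obtain ⟨c, hc⟩ := exists_pow_six_eq (orderOf_dvd_iff_pow_eq_one.mp (hlam ▸ hd))
  obtain ⟨σ₀, hσ⟩ := hb.2 (diagGL (ZMod l) (lam, 1))
  have hmat : (rhoTilde W l b σ₀ : Matrix (Fin 2) (Fin 2) (ZMod l)) = !![(lam : ZMod l), 0; 0, 1] := by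
    rw [hσ, coe_diagGL, Units.val_one]
  refine ⟨σ₀, ?_, ?_, lam, hlam, hmat, ?_, ?_⟩
  · refine mem_galOver_of_rhoTilde_eq_pow b hb (g := diagGL (ZMod l) (c, 1)) ?_
    rw [hσ, ← map_pow, Prod.pow_mk, hc, one_pow]
  · rw [← orderOf_injective _ hb.1, hσ, orderOf_injective _ (diagGL_injective _), Prod.orderOf,
      orderOf_one, hlam, Nat.lcm_one_right]
  · intro v hv
    obtain ⟨a, rfl⟩ := Submodule.mem_span_singleton.mp hv
    rw [map_smul, galAct_apply_basis, hmat]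
    simp [smul_comm a]
  · intro v hv
    obtain ⟨a, rfl⟩ := Submodule.mem_span_singleton.mp hv
    rw [map_smul, galAct_apply_basis, hmat]
    simp

theorem existsUnique_rhoTilde_eq (b : Module.Basis (Fin 2) (ZMod l) (ellTorsion W l))
    (hb : Function.Bijective (rhoTilde W l b)) (g : GL (Fin 2) (ZMod l)) :
    ∃! s : DivGal W l, (rhoTilde W l b s : Matrix (Fin 2) (Fin 2) (ZMod l)) = g := by
  obtain ⟨s, hs⟩ := hb.2 g
  exact ⟨s, congrArg Units.val hs, fun t ht => hb.1 ((Units.ext ht).trans hs.symm)⟩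

theorem transvection_mem_and_not_stable
    (b : Module.Basis (Fin 2) (ZMod l) (ellTorsion W l))
    {H : Subgroup (DivGal W l)} (hb : Function.Bijective (rhoTilde W l b))
    (hH : (toGL : SpecialLinearGroup (Fin 2) (ZMod l) →* _).range ≤ H.map (rhoTilde W l b)) :
    (∃! τ : DivGal W l,
        (rhoTilde W l b τ : Matrix (Fin 2) (Fin 2) (ZMod l)) = !![1, 0; 1, 1]) ∧
      ∀ τ : DivGal W l, (rhoTilde W l b τ : Matrix (Fin 2) (Fin 2) (ZMod l)) = !![1, 0; 1, 1] →
        τ ∈ H ∧ ¬ (Submodule.span (ZMod l) {b 0}).map (galAct W l τ) ≤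
          Submodule.span (ZMod l) {b 0} := by
  let v : SpecialLinearGroup (Fin 2) (ZMod l) := ⟨!![1, 0; 1, 1], by simp [det_fin_two]⟩
  have hv : ((toGL v : GL (Fin 2) (ZMod l)) : Matrix (Fin 2) (Fin 2) (ZMod l)) = !![1, 0; 1, 1] := rfl
  refine ⟨hv ▸ existsUnique_rhoTilde_eq b hb (toGL v), fun τ hτ => ⟨?_, fun h => ?_⟩⟩
  · obtain ⟨t, ht, htv⟩ := hH ⟨v, rfl⟩
    have : rhoTilde W l b τ = rhoTilde W l b t := by
      rw [htv]
      exact Units.ext hτ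
    rwa [hb.1 this]
  · have h1 := h (Submodule.mem_map_of_mem (Submodule.mem_span_singleton_self (b 0)))
    rw [galAct_apply_basis, hτ] at h1
    obtain ⟨a, ha⟩ := Submodule.mem_span_singleton.mp h1
    have h2 := congrArg (fun w => b.repr w 1) ha
    simp at h2

theorem scalar_mem_center_and_bijective (b : Module.Basis (Fin 2) (ZMod l) (ellTorsion W l))
    {H : Subgroup (DivGal W l)} (hb : Function.Bijective (rhoTilde W l b)) {lam : (ZMod l)ˣ}
    (hlam : lam ≠ 1)
    (hH : ∀ s, rhoTilde W l b s = diagGL (ZMod l) (lam, lam) → s ∈ H) :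
    (∃! β : DivGal W l, (rhoTilde W l b β : Matrix (Fin 2) (Fin 2) (ZMod l)) =
        !![(lam : ZMod l), 0; 0, (lam : ZMod l)]) ∧
      ∀ β : DivGal W l, (rhoTilde W l b β : Matrix (Fin 2) (Fin 2) (ZMod l)) =
          !![(lam : ZMod l), 0; 0, (lam : ZMod l)] →
        β ≠ 1 ∧ (∃ hβ : β ∈ H, (⟨β, hβ⟩ : H) ∈ Subgroup.center H) ∧
          Function.Bijective ⇑(galAct W l β - (1 : Module.End (ZMod l) (ellTorsion W l))) := by
  refine ⟨existsUnique_rhoTilde_eq b hb (diagGL (ZMod l) (lam, lam)), fun β hβ => ?_⟩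
  have hmat : rhoTilde W l b β = diagGL (ZMod l) (lam, lam) := Units.ext hβ
  refine ⟨?_, ⟨hH β hmat, ?_⟩, ?_⟩
  · rintro rfl
    rw [map_one, ← map_one (diagGL (ZMod l))] at hmat
    exact hlam (congrArg Prod.fst (diagGL_injective _ hmat)).symm
  · refine Subgroup.mem_center_iff.mpr fun s => Subtype.ext (hb.1 ?_)
    change rhoTilde W l b (s * β) = rhoTilde W l b (β * s)
    rw [map_mul, map_mul]
    refine Units.ext ?_
    have hs : !![(lam : ZMod l), 0; 0, (lam : ZMod l)] =
        (lam : ZMod l) • (1 : Matrix (Fin 2) (Fin 2) (ZMod l)) := by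
      simp [one_fin_two]
    rw [Units.val_mul, Units.val_mul, hβ, hs, mul_smul_comm, smul_mul_assoc, mul_one, one_mul]
  · have hact : galAct W l β - (1 : Module.End (ZMod l) (ellTorsion W l)) =
        ((lam : ZMod l) - 1) • (1 : Module.End (ZMod l) (ellTorsion W l)) := by
      refine b.ext fun j => ?_
      rw [LinearMap.sub_apply, galAct_apply_basis, hβ, LinearMap.smul_apply, Module.End.one_apply,
        sub_smul, one_smul]
      fin_cases j <;> simp
    have h0 : (lam : ZMod l) - 1 ≠ 0 := fun h => hlam (Units.ext (sub_eq_zero.mp h))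
    rw [hact]
    refine Function.bijective_iff_has_inverse.mpr
      ⟨fun v => ((lam : ZMod l) - 1)⁻¹ • v, fun v => ?_, fun v => ?_⟩
    · change ((lam : ZMod l) - 1)⁻¹ • ((lam : ZMod l) - 1) • v = v
      rw [smul_smul, inv_mul_cancel₀ h0, one_smul]
    · rw [LinearMap.smul_apply, Module.End.one_apply, smul_smul, mul_inv_cancel₀ h0, one_smul]

/-- The quotient is 1 only if `l - 1` divides 12, and the primes with this property are exactly the
excluded ones. -/
theorem div_gcd_twelve_ne_one (hl : l ≠ 2 ∧ l ≠ 3 ∧ l ≠ 5 ∧ l ≠ 7 ∧ l ≠ 13) :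
    (l - 1) / Nat.gcd (l - 1) 12 ≠ 1 := by
  intro h
  have hp : l.Prime := Fact.out
  have h1 := Nat.div_mul_cancel (Nat.gcd_dvd_left (l - 1) 12)
  rw [h, one_mul] at h1
  have h2 : l - 1 ∣ 12 := h1 ▸ Nat.gcd_dvd_right (l - 1) 12
  have h3 : l ≤ 13 := by
    have := Nat.le_of_dvd (by norm_num) h2
    omega
  interval_cases l <;> first | omega | (revert hp; norm_num)

end GaloisImage

/-! ### Assembly of a) to g). -/

theorem lemma9 (A B : ℤ) (l : ℕ) [Fact l.Prime]
    (hl : l ≠ 2 ∧ l ≠ 3 ∧ l ≠ 5 ∧ l ≠ 7 ∧ l ≠ 13)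
    (hCM : ¬ HasCM (shortCurve A B))
    (hGL : Nonempty (DivGal (shortCurve A B) l ≃*
      Matrix.GeneralLinearGroup (Fin 2) (ZMod l)))
    (hdisc : ¬ (l : ℤ) ∣ 4 * A ^ 3 + 27 * B ^ 2)
    (C : ℝ) (hC : 0 < C) :
    -- a)
    (IsGreatest {M : IntermediateField ℚ QBar |
        M ≤ divisionField (shortCurve A B) l ∧ IsAbelianSubext M} (cycloField l) ∧
      ∀ b : Module.Basis (Fin 2) (ZMod l) (ellTorsion (shortCurve A B) l),
        (galOver (shortCurve A B) l (cycloField l)).map (rhoTilde (shortCurve A B) l b) =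
          (Matrix.SpecialLinearGroup.toGL :
            Matrix.SpecialLinearGroup (Fin 2) (ZMod l) →* _).range) ∧
    -- b)
    (divisionField (shortCurve A B) l ⊓ fieldK2 l C = ⊥ ∧
      Module.finrank ℚ ↥(divisionField (shortCurve A B) l ⊓ fieldK3 l C) = 2) ∧
    -- c)
    divisionField (shortCurve A B) l ⊓ fieldK' A B l C ≤ cycloField l ∧
    -- d)
    (divisionField (shortCurve A B) l ⊓ fieldK' A B l C = cycloField l ⊓ fieldK' A B l C ∧
      Module.finrank ℚ ↥(divisionField (shortCurve A B) l ⊓ fieldK' A B l C) ∣ 12) ∧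
    -- e), f), g), in every basis of the `ℓ`-torsion
    ∀ b : Module.Basis (Fin 2) (ZMod l) (ellTorsion (shortCurve A B) l),
      -- e)
      (∀ d₀ : ℕ, d₀.Prime → d₀ ∣ (l - 1) / Nat.gcd (l - 1) 12 →
        ∃ σ₀ ∈ galOver (shortCurve A B) l (fieldK' A B l C), orderOf σ₀ = d₀ ∧
          ∃ lam : (ZMod l)ˣ, orderOf lam = d₀ ∧
            (rhoTilde (shortCurve A B) l b σ₀ : Matrix (Fin 2) (Fin 2) (ZMod l)) =
              !![(lam : ZMod l), 0; 0, 1] ∧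
            (∀ v ∈ Submodule.span (ZMod l) {b 0},
              galAct (shortCurve A B) l σ₀ v = (lam : ZMod l) • v) ∧
            (∀ v ∈ Submodule.span (ZMod l) {b 1},
              galAct (shortCurve A B) l σ₀ v = v)) ∧
      -- f)
      ((∃! τ : DivGal (shortCurve A B) l,
          (rhoTilde (shortCurve A B) l b τ : Matrix (Fin 2) (Fin 2) (ZMod l)) =
            !![1, 0; 1, 1]) ∧
        ∀ τ : DivGal (shortCurve A B) l,
          (rhoTilde (shortCurve A B) l b τ : Matrix (Fin 2) (Fin 2) (ZMod l)) =
            !![1, 0; 1, 1] →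
          τ ∈ galOver (shortCurve A B) l (fieldK' A B l C) ∧
          ¬ (Submodule.span (ZMod l) {b 0}).map (galAct (shortCurve A B) l τ) ≤
            Submodule.span (ZMod l) {b 0}) ∧
      -- g)
      ((∃ lam : (ZMod l)ˣ, orderOf lam = (l - 1) / Nat.gcd (l - 1) 12) ∧
        ∀ lam : (ZMod l)ˣ, orderOf lam = (l - 1) / Nat.gcd (l - 1) 12 →
          (∃! β : DivGal (shortCurve A B) l,
            (rhoTilde (shortCurve A B) l b β : Matrix (Fin 2) (Fin 2) (ZMod l)) =
              !![(lam : ZMod l), 0; 0, (lam : ZMod l)]) ∧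
          ∀ β : DivGal (shortCurve A B) l,
            (rhoTilde (shortCurve A B) l b β : Matrix (Fin 2) (Fin 2) (ZMod l)) =
              !![(lam : ZMod l), 0; 0, (lam : ZMod l)] →
            β ≠ 1 ∧
            (∃ hβ : β ∈ galOver (shortCurve A B) l (fieldK' A B l C),
              (⟨β, hβ⟩ : ↥(galOver (shortCurve A B) l (fieldK' A B l C))) ∈
                Subgroup.center ↥(galOver (shortCurve A B) l (fieldK' A B l C))) ∧
            Function.Bijective
              ⇑(galAct (shortCurve A B) l β - (1 : Module.End (ZMod l) (ellTorsion (shortCurve A B) l)))) := by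
  have hl5 : 5 ≤ l := by
    have hp : l.Prime := Fact.out
    have := hp.two_le
    by_contra h
    have h4 : l = 4 := by omega
    rw [h4] at hp
    exact absurd hp (by norm_num)
  have hell : (shortCurve A B).IsElliptic :=
    shortCurve_isElliptic fun h => hdisc (h ▸ dvd_zero _)
  have hbij := rhoTilde_bijective hGL
  obtain ⟨e⟩ := hGL
  obtain ⟨ζ, hζL, hζ⟩ := exists_isPrimitiveRoot_mem_divisionField (by omega)
    (exists_mul_ne_mul_of_mulEquiv e)
  have hcyclo : cycloField l ≤ divisionField (shortCurve A B) l := by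
    rw [cycloField_eq_adjoin hζ, IntermediateField.adjoin_le_iff, Set.singleton_subset_iff]
    exact hζL
  have hgal := galOver_cycloField hl5 e hζ hcyclo
  have hpow := pow_six_mem_galOver_fieldK' (W := shortCurve A B) (l := l) (A := A) (B := B) (C := C)
  have hcomm : commutator (DivGal (shortCurve A B) l) ≤
      galOver (shortCurve A B) l (fieldK' A B l C) :=
    commutator_le_of_pow_mem e (two_ne_zero_zmod hl5) (two_sq_ne_one_zmod hl5)
      (six_ne_zero_zmod hl5) _ hpow
  have hc : divisionField (shortCurve A B) l ⊓ fieldK' A B l C ≤ cycloField l :=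
    inf_le_of_galInter_le (hgal.le.trans hcomm)
  refine ⟨⟨isGreatest_cycloField hl5 e hζ hcyclo, fun b => ?_⟩,
    inf_fieldK2_and_finrank_inf_fieldK3 hl5 e hζ hζL C, hc,
    ⟨le_antisymm (le_inf hc inf_le_right) (inf_le_inf_right _ hcyclo),
      -- The degree even divides 6.
      (finrank_inf_dvd hl5 e (six_ne_zero_zmod hl5) hpow).trans (by norm_num)⟩,
    fun b => ⟨fun d₀ _ hd => exists_galOver_diag b (hbij b) hd, ?_,
      exists_orderOf_eq (Nat.div_dvd_of_dvd (Nat.gcd_dvd_left _ _)), fun lam hlam => ?_⟩⟩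
  · rw [hgal]
    exact map_rhoTilde_commutator hl5 b (hbij b)
  · refine transvection_mem_and_not_stable b (hbij b) ?_
    rw [← map_rhoTilde_commutator hl5 b (hbij b)]
    exact Subgroup.map_mono hcomm
  · refine scalar_mem_center_and_bijective b (hbij b) ?_ fun s hs => ?_
    · rintro rfl
      exact div_gcd_twelve_ne_one hl (by rw [← hlam, orderOf_one])
    · obtain ⟨c, hc⟩ := exists_pow_six_eq (orderOf_dvd_iff_pow_eq_one.mp hlam.dvd)
      refine mem_galOver_of_rhoTilde_eq_pow b (hbij b) (g := diagGL (ZMod l) (c, c)) ?_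
      rw [hs, ← map_pow, Prod.pow_mk, hc]
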